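/- Let $\mathbb B=\{u+\mathbf j v: u,v\in\mathbb C\}$ be the commutative algebra of bicomplex numbers ($\mathbf j^2=-1$), with $\operatorname{Sc}(u+\mathbf jv)=u$, $\operatorname{Vec}(u+\mathbf jv)=v$ and norm $|u+\mathbf jv|_{\mathbb B}=\sqrt{|u|^2+|v|^2}$. Let $\Omega\subset\mathbb C$ be a bounded domain that is star-shaped with respect to $0\in\Omega$, and put $\varrho=\sup_{z\in\Omega}|z|$. Let $q_f\in C^1[0,\varrho]$ be complex-valued and let $f\in C^2[0,\varrho]$ be a complex-valued function without zeros in $[0,\varrho]$ such that $f''+\frac1r f'-q_f f=0$ on $(0,\varrho)$. Put $q_{1/f}=2(f'/f)^2-q_f$. For a potential $q\in\{q_f,q_{1/f}\}$, a kernel for $q$ is a function $G\in C([0,\varrho]\times[0,1])\cap C^2([0,\varrho]\times[0,1))$ satisfying $$r\,(G_{rr}-qG)-G_r+2(1-t)G_{rt}=0\quad\text{in }(0,\varrho)\times(0,1),\qquad G(r,0)=\int_0^r\tau q(\tau)\,d\tau,\qquad G(0,t)=0 .$$ Kernels for $q_f$ and for $q_{1/f}$ exist. For any kernels $G^f$ for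 $q_f$ and $G^{1/f}$ for $q_{1/f}$, define operators on $C(\Omega)=C(\Omega;\mathbb C)$ by $$\mathbf T_f u(z)=u(z)+\int_0^1\sigma\,G^f(|z|,1-\sigma^2)\,u(\sigma^2z)\,d\sigma,\qquad \mathbf T_{1/f} u(z)=u(z)+\int_0^1\sigma\,G^{1/f}(|z|,1-\sigma^2)\,u(\sigma^2z)\,d\sigma,$$ and operators on $C(\Omega;\mathbb B)$ by $\mathcal T_f=\mathbf T_f\operatorname{Sc}+\mathbf j\,\mathbf T_{1/f}\operatorname{Vec}$ and $\mathcal T_{1/f}=\mathbf T_{1/f}\operatorname{Sc}+\mathbf j\,\mathbf T_{f}\operatorname{Vec}$. Give $C(\Omega)$ and $C(\Omega;\mathbb B)$ their Fréchet topologies of uniform convergence on compact subsets of $\Omega$. Then $\mathbf T_f$ and $\mathbf T_{1/f}$ are continuous $\mathbb C$-linear bijections of $C(\Omega)$ with continuous inverses, $\mathcal T_f$ and $\mathcal T_{1/f}$ are continuous $\mathbb C$-linear bijections of $C(\Omega;\mathbb B)$ with continuous inverses, and $$\mathcal T_f^{-1}=\mathbf T_f^{-1}\operatorname{Sc}+\mathbf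 j\,\mathbf T_{1/f}^{-1}\operatorname{Vec},\qquad \mathcal T_{1/f}^{-1}=\mathbf T_{1/f}^{-1}\operatorname{Sc}+\mathbf j\,\mathbf T_{f}^{-1}\operatorname{Vec}.$$ -/

import Mathlib

open Set Topology

/-- The bicomplex numbers: pairs `(w₁, w₂)` of complex numbers, written `w₁ + 𝐣 w₂`, with `𝐣² = -1`.
The product is `(w₁, w₂)(z₁, z₂) = (w₁ z₁ - w₂ z₂, w₁ z₂ + w₂ z₁)`, see `Bicomplex.mul_eq`. -/
abbrev Bicomplex : Type := QuadraticAlgebra ℂ (-1) 0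

namespace Bicomplex

/-- The scalar part. -/
def Sc (W : Bicomplex) : ℂ := W.re

/-- The vectorial part. -/
def Vec (W : Bicomplex) : ℂ := W.im

/-- The bicomplex unit `𝐣 = (0, 1)`. -/
def j : Bicomplex := ⟨0, 1⟩

theorem mul_eq (W Z : Bicomplex) :
    W * Z = ⟨W.Sc * Z.Sc - W.Vec * Z.Vec, W.Sc * Z.Vec + W.Vec * Z.Sc⟩ := by
  ext
  · simp [Sc, Vec]
    ring
  · simp [Sc, Vec]

theorem j_mul_j : j * j = -1 := by
  ext <;> simp [j, QuadraticAlgebra.re_one, QuadraticAlgebra.im_one]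

/-- `W ↦ (Sc W, Vec W)` into `ℂ²` with its Euclidean norm. -/
noncomputable def toEuclidean : Bicomplex →ₗ[ℂ] WithLp 2 (ℂ × ℂ) where
  toFun W := WithLp.toLp 2 (W.Sc, W.Vec)
  map_add' _ _ := rfl
  map_smul' _ _ := rfl

theorem toEuclidean_injective : Function.Injective toEuclidean := by
  intro W Z h
  have h' : (W.Sc, W.Vec) = (Z.Sc, Z.Vec) := congrArg WithLp.ofLp h
  exact QuadraticAlgebra.ext (congrArg Prod.fst h') (congrArg Prod.snd h')

/-- The bicomplex norm `|W| = √(|Sc W|² + |Vec W|²)`, see `Bicomplex.norm_eq`. -/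
noncomputable instance : NormedAddCommGroup Bicomplex :=
  NormedAddCommGroup.induced Bicomplex (WithLp 2 (ℂ × ℂ)) toEuclidean toEuclidean_injective

noncomputable instance : NormedSpace ℂ Bicomplex :=
  NormedSpace.induced ℂ Bicomplex (WithLp 2 (ℂ × ℂ)) toEuclidean

theorem norm_eq (W : Bicomplex) : ‖W‖ = √(‖W.Sc‖ ^ 2 + ‖W.Vec‖ ^ 2) :=
  WithLp.prod_norm_eq_of_L2 (WithLp.toLp 2 (W.Sc, W.Vec))

theorem isometry_toEuclidean : Isometry toEuclidean :=
  AddMonoidHomClass.isometry_of_norm toEuclidean fun _ => rfl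

theorem continuous_Sc : Continuous Sc :=
  ((WithLp.prod_continuous_ofLp 2 ℂ ℂ).fst).comp isometry_toEuclidean.continuous

theorem continuous_Vec : Continuous Vec :=
  ((WithLp.prod_continuous_ofLp 2 ℂ ℂ).snd).comp isometry_toEuclidean.continuous

/-- `u + 𝐣 v`, for complex `u` and `v`. -/
noncomputable def ofParts (u v : ℂ) : Bicomplex := algebraMap ℂ Bicomplex u + j * algebraMap ℂ Bicomplex v

theorem ofParts_eq (u v : ℂ) : ofParts u v = ⟨u, v⟩ := by
  ext <;> simp [ofParts, j]

theorem continuous_ofParts : Continuous fun p : ℂ × ℂ => ofParts p.1 p.2 := by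
  rw [isometry_toEuclidean.isEmbedding.continuous_iff]
  have h : (toEuclidean ∘ fun p : ℂ × ℂ => ofParts p.1 p.2) = WithLp.toLp 2 := by
    funext p
    simp [toEuclidean, ofParts_eq, Sc, Vec]
  rw [h]
  exact WithLp.prod_continuous_toLp 2 ℂ ℂ

end Bicomplex

namespace Transmutation

/-- `ϱ_Ω = sup {|z| : z ∈ Ω}`. -/
noncomputable def outerRadius (Ω : Set ℂ) : ℝ := sSup ((fun z : ℂ => ‖z‖) '' Ω)

/-- The Darboux transformed potential `q_{1/f} = 2 (f'/f)² - q_f` on `[0, ϱ]`. -/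
noncomputable def darbouxPotential (ϱ : ℝ) (f q : ℝ → ℂ) (r : ℝ) : ℂ :=
  2 * (derivWithin f (Icc 0 ϱ) r / f r) ^ 2 - q r

/-- `G` is a transmutation kernel on `[0, ϱ] × [0, 1]` for the radial Schrödinger operator with
potential `q`: a classical solution of the characteristic boundary value problem
`r (G_rr - q G) - G_r + 2 (1 - t) G_rt = 0`, `G(r, 0) = ∫₀ʳ τ q(τ) dτ`, `G(0, t) = 0`. -/
structure IsKernel (ϱ : ℝ) (q : ℝ → ℂ) (G : ℝ → ℝ → ℂ) : Prop where
  continuousOn : ContinuousOn (fun p : ℝ × ℝ => G p.1 p.2) (Icc 0 ϱ ×ˢ Icc 0 1)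
  contDiffOn : ContDiffOn ℝ 2 (fun p : ℝ × ℝ => G p.1 p.2) (Icc 0 ϱ ×ˢ Ico 0 1)
  pde : ∀ r ∈ Ioo 0 ϱ, ∀ t ∈ Ioo (0 : ℝ) 1,
    (r : ℂ) * (deriv (fun s => deriv (fun s' => G s' t) s) r - q r * G r t)
      - deriv (fun s => G s t) r
      + 2 * (1 - (t : ℂ)) * deriv (fun τ => deriv (fun s => G s τ) r) t = 0
  initial : ∀ r ∈ Icc 0 ϱ, G r 0 = ∫ τ in (0 : ℝ)..r, (τ : ℂ) * q τ
  boundary : ∀ t ∈ Icc (0 : ℝ) 1, G 0 t = 0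

theorem norm_mem_Icc {Ω : Set ℂ} (hb : Bornology.IsBounded Ω) {z : ℂ} (hz : z ∈ Ω) :
    ‖z‖ ∈ Icc 0 (outerRadius Ω) := by
  obtain ⟨C, hC⟩ := hb.exists_norm_le
  refine ⟨norm_nonneg z, le_csSup ⟨C, ?_⟩ ⟨z, hz, rfl⟩⟩
  rintro _ ⟨w, hw, rfl⟩
  exact hC w hw

theorem sq_mul_mem {Ω : Set ℂ} (hs : StarConvex ℝ 0 Ω) {z : ℂ} (hz : z ∈ Ω) {σ : ℝ}
    (hσ : σ ∈ Icc (0 : ℝ) 1) : ((σ : ℂ) ^ 2 * z) ∈ Ω := by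
  have h := hs.smul_mem hz (sq_nonneg σ) (pow_le_one₀ hσ.1 hσ.2)
  simpa [Complex.real_smul] using h

/-- The function `z ↦ u(z) + ∫₀¹ σ G(|z|, 1 - σ²) u(σ² z) dσ` on `Ω`.  The point `σ² z` lies in `Ω`
for `0 ≤ σ ≤ 1`; outside `Ω` the integrand is set to `0`, which has no effect. -/
noncomputable def radialFun (Ω : Set ℂ) (G : ℝ → ℝ → ℂ) (u : Ω → ℂ) (z : Ω) : ℂ :=
  open Classical in
  u z + ∫ σ in (0 : ℝ)..1, (σ : ℂ) * G ‖(z : ℂ)‖ (1 - σ ^ 2) *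
    (if h : (σ : ℂ) ^ 2 * (z : ℂ) ∈ Ω then u ⟨(σ : ℂ) ^ 2 * (z : ℂ), h⟩ else 0)

theorem continuous_radialFun {Ω : Set ℂ} (hs : StarConvex ℝ 0 Ω) (hb : Bornology.IsBounded Ω)
    {G : ℝ → ℝ → ℂ}
    (hG : ContinuousOn (fun p : ℝ × ℝ => G p.1 p.2) (Icc 0 (outerRadius Ω) ×ˢ Icc 0 1))
    (u : C(Ω, ℂ)) : Continuous (radialFun Ω G u) := by
  classical
  let c : ℝ → ℝ := fun σ => (projIcc (0 : ℝ) 1 zero_le_one σ : ℝ)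
  have hc : Continuous c := continuous_subtype_val.comp continuous_projIcc
  have hcm : ∀ σ, c σ ∈ Icc (0 : ℝ) 1 := fun σ => (projIcc (0 : ℝ) 1 zero_le_one σ).2
  let F : Ω → ℝ → ℂ := fun z σ => (σ : ℂ) * G ‖(z : ℂ)‖ (1 - c σ ^ 2) *
    u ⟨(c σ : ℂ) ^ 2 * (z : ℂ), sq_mul_mem hs z.2 (hcm σ)⟩
  have hF : Continuous F.uncurry := by
    refine Continuous.mul (Continuous.mul ?_ ?_) ?_
    · exact Complex.continuous_ofReal.comp continuous_snd
    · refine hG.comp_continuous (f := fun p : Ω × ℝ => (‖(p.1 : ℂ)‖, 1 - c p.2 ^ 2)) ?_ ?_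
      · fun_prop
      · rintro ⟨z, σ⟩
        have := hcm σ
        refine ⟨norm_mem_Icc hb z.2, ?_, ?_⟩
        · have := pow_le_one₀ (n := 2) this.1 this.2
          simp only
          linarith
        · have := sq_nonneg (c σ)
          simp only
          linarith
    · refine u.continuous.comp (Continuous.subtype_mk ?_ _)
      fun_prop
  have hEq : radialFun Ω G u = fun z => u z + ∫ σ in (0 : ℝ)..1, F z σ := by
    funext z
    unfold radialFun
    congr 1
    refine intervalIntegral.integral_congr fun σ hσ => ?_
    rw [uIcc_of_le zero_le_one] at hσ
    have hcσ : c σ = σ := congrArg Subtype.val (projIcc_of_mem zero_le_one hσ)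
    simp only [F, hcσ, dif_pos (sq_mul_mem hs z.2 hσ)]
  rw [hEq]
  exact u.continuous.add
    (intervalIntegral.continuous_parametric_intervalIntegral_of_continuous' hF 0 1)

/-- The operator `𝐓 u(z) = u(z) + ∫₀¹ σ G(|z|, 1 - σ²) u(σ² z) dσ` on `C(Ω)`. -/
noncomputable def radialOp {Ω : Set ℂ} (hs : StarConvex ℝ 0 Ω) (hb : Bornology.IsBounded Ω)
    {q : ℝ → ℂ} {G : ℝ → ℝ → ℂ} (hG : IsKernel (outerRadius Ω) q G) (u : C(Ω, ℂ)) : C(Ω, ℂ) :=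
  ⟨radialFun Ω G u, continuous_radialFun hs hb hG.continuousOn u⟩

/-- The operator `A Sc + 𝐣 B Vec` on `C(Ω; 𝔹)`, for operators `A` and `B` on `C(Ω)`. -/
noncomputable def bicomplexOp {Ω : Set ℂ} (A B : C(Ω, ℂ) → C(Ω, ℂ)) (W : C(Ω, Bicomplex)) :
    C(Ω, Bicomplex) where
  toFun z := Bicomplex.ofParts
    (A ⟨fun ζ => (W ζ).Sc, Bicomplex.continuous_Sc.comp W.continuous⟩ z)
    (B ⟨fun ζ => (W ζ).Vec, Bicomplex.continuous_Vec.comp W.continuous⟩ z)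
  continuous_toFun := Bicomplex.continuous_ofParts.comp
    ((ContinuousMap.continuous _).prodMk (ContinuousMap.continuous _))

end Transmutation

/-! ### Weighted contractions on spaces of continuous functions and the Neumann series. -/

namespace ContinuousMap

/-! Each radial operator is `1 - S` with `S` of Volterra type: `S u (z)` only reads `u` on the
segment `[0, z]`. On the radial hull of a compact set, `S` halves the supremum norm with weight `exp
(l |z|)` for large `l`. Away from the origin the gain comes from integrating the exponential. Near
the origin it comes from `G(0, t) = 0`: there `|G| ≤ 1`, and `∫₀¹ σ dσ = 1/2`. This is
`isWeightedContraction_radialLinear`. Hence the Neumann series converges locally uniformly and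
provides a continuous inverse (`oneSubEquiv`). The bicomplex operators act on the two components
separately, so their inverses do too.

Existence of kernels is a Goursat problem. With `τ = -½ log (1 - t)`, `p = r e^{-τ}` and `G = e^{2τ}
M(p, τ)`, the equation becomes `M_{pτ} = V M`, with `V = p e^{2τ} q(p e^τ)`, and the data become
`M(0, τ) = 0` and `M(p, 0) = ∫₀ᵖ s q(s) ds`. These coordinates send the edge `t = 1` to infinity,
where continuity of `G` is still required. The integral equation is therefore solved for `k = G /
r²` in the variables `r` and `a = √(1 - t)`, which keep that edge at `a = 0`. It is again a Volterra
equation, with weight `exp (l |r| max(1, |a|))`, so the same contraction principle yields a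
continuous `k` on the plane (`exists_kernelOp_solution`). Going back to `M`, its partial derivatives
are integrals of `V M`, which upgrades continuity to `C²` (`contDiff_two_goursat`), and `kernel_pde`
returns the original equation. Since `f` is `C²` without zeros, the Darboux potential is `C¹`, and
one existence result serves both potentials. -/

theorem continuous_of_forall_norm_le {X Y : Type*} [TopologicalSpace X] [TopologicalSpace Y]
    (L : C(X, ℂ) →ₗ[ℂ] C(Y, ℂ))
    (h : ∀ K : Set Y, IsCompact K → ∃ K' : Set X, IsCompact K' ∧ ∃ C : ℝ, ∀ u : C(X, ℂ), ∀ B : ℝ,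
      0 ≤ B → (∀ x ∈ K', ‖u x‖ ≤ B) → ∀ y ∈ K, ‖L u y‖ ≤ B * C) :
    Continuous L := by
  refine continuous_of_continuousAt_zero L ?_
  rw [ContinuousAt, map_zero, tendsto_iff_forall_isCompact_tendstoUniformlyOn]
  intro K hK
  obtain ⟨K', hK', C, hC⟩ := h K hK
  rw [Metric.tendstoUniformlyOn_iff]
  intro ε hε
  have h0 := (tendsto_iff_forall_isCompact_tendstoUniformlyOn (f := (0 : C(X, ℂ))).1
    Filter.tendsto_id) K' hK'
  rw [Metric.tendstoUniformlyOn_iff] at h0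
  have hC' : 0 < |C| + 1 := by positivity
  filter_upwards [h0 (ε / (|C| + 1)) (by positivity)] with u hu y hy
  have h1 := hC u (ε / (|C| + 1)) (by positivity) (fun x hx => by simpa using (hu x hx).le) y hy
  simp only [zero_apply, dist_zero_left]
  refine h1.trans_lt ?_
  rw [div_mul_eq_mul_div, div_lt_iff₀ hC']
  nlinarith [le_abs_self C]

/-- A linear operator on `C(X, ℂ)` which, over arbitrarily large compact sets, is a contraction of
ratio `1/2` for a suitable weighted supremum norm. -/
def IsWeightedContraction {X : Type*} [TopologicalSpace X] (S : C(X, ℂ) →ₗ[ℂ] C(X, ℂ)) : Prop :=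
  ∀ K : Set X, IsCompact K → ∃ K' : Set X, IsCompact K' ∧ K ⊆ K' ∧ ∃ (ω : X → ℝ) (W : ℝ),
    (∀ x ∈ K', 1 ≤ ω x ∧ ω x ≤ W) ∧ ∀ u : C(X, ℂ), ∀ C : ℝ, 0 ≤ C →
      (∀ x ∈ K', ‖u x‖ ≤ C * ω x) → ∀ x ∈ K', ‖S u x‖ ≤ C / 2 * ω x

namespace IsWeightedContraction

variable {X : Type*} [TopologicalSpace X] {S : C(X, ℂ) →ₗ[ℂ] C(X, ℂ)}

theorem continuous (hS : IsWeightedContraction S) : Continuous S := by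
  refine continuous_of_forall_norm_le S fun K hK => ?_
  obtain ⟨K', h1, h2, ω, W, h3, h4⟩ := hS K hK
  refine ⟨K', h1, W / 2, fun u B hB hu y hy => ?_⟩
  refine (h4 u B hB (fun x hx => (hu x hx).trans ?_) y (h2 hy)).trans ?_
  · nlinarith [(h3 x hx).1]
  · nlinarith [(h3 y (h2 hy)).2]

/-- The bound on `S u` lives on the same set `K'` as the bound on `u`, so it can be iterated without
enlarging the set. -/
theorem norm_iterate_le {K' : Set X} {ω : X → ℝ}
    (h4 : ∀ u : C(X, ℂ), ∀ C : ℝ, 0 ≤ C →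
      (∀ x ∈ K', ‖u x‖ ≤ C * ω x) → ∀ x ∈ K', ‖S u x‖ ≤ C / 2 * ω x)
    (u : C(X, ℂ)) {C : ℝ} (hC : 0 ≤ C) (hu : ∀ x ∈ K', ‖u x‖ ≤ C * ω x) (n : ℕ) :
    ∀ x ∈ K', ‖(S^[n]) u x‖ ≤ C * (1 / 2) ^ n * ω x := by
  induction n with
  | zero => simpa using hu
  | succ n ih =>
    intro x hx
    rw [Function.iterate_succ_apply']
    refine (h4 _ _ (by positivity) ih x hx).trans (le_of_eq ?_)
    ring

theorem summable_iterate [LocallyCompactSpace X] (hS : IsWeightedContraction S) (v : C(X, ℂ)) :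
    Summable fun n => (S^[n]) v := by
  refine summable_of_locally_summable_norm fun K => ?_
  obtain ⟨K', h1, h2, ω, W, h3, h4⟩ := hS K K.isCompact
  obtain ⟨B, hB⟩ := h1.exists_bound_of_continuousOn v.continuous.continuousOn
  have hg : Summable fun n : ℕ => |B| * (1 / 2 : ℝ) ^ n * |W| :=
    ((summable_geometric_two).mul_left _).mul_right _
  refine Summable.of_nonneg_of_le (fun _ => norm_nonneg _) (fun n => ?_) hg
  rw [ContinuousMap.norm_le _ (by positivity)]
  rintro ⟨x, hx⟩
  refine (norm_iterate_le h4 v (abs_nonneg B) (fun y hy => ?_) n x (h2 hx)).trans ?_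
  · have := (h3 y hy).1
    nlinarith [hB y hy, le_abs_self B, abs_nonneg B]
  · gcongr
    exact (h3 x (h2 hx)).2.trans (le_abs_self W)

/-- A kernel element of `1 - S` is a fixed point of `S`, hence of every iterate, and the geometric
bound forces it to vanish. -/
theorem injective (hS : IsWeightedContraction S) :
    Function.Injective (LinearMap.id - S : C(X, ℂ) →ₗ[ℂ] C(X, ℂ)) := by
  rw [injective_iff_map_eq_zero]
  intro u hu
  have hSu : S u = u := by
    have h0 : u - S u = 0 := hu
    exact (sub_eq_zero.1 h0).symm
  ext x
  obtain ⟨K', h1, h2, ω, W, h3, h4⟩ := hS {x} isCompact_singleton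
  have hx : x ∈ K' := h2 rfl
  obtain ⟨B, hB⟩ := h1.exists_bound_of_continuousOn u.continuous.continuousOn
  have hle : ∀ n : ℕ, ‖u x‖ ≤ |B| * (1 / 2) ^ n * ω x := by
    intro n
    have := norm_iterate_le h4 u (abs_nonneg B) (fun y hy => ?_) n x hx
    · rwa [Function.iterate_fixed hSu] at this
    · have := (h3 y hy).1
      nlinarith [hB y hy, le_abs_self B, abs_nonneg B]
  have hlim : Filter.Tendsto (fun n : ℕ => |B| * (1 / 2 : ℝ) ^ n * ω x) Filter.atTop (𝓝 0) := by
    simpa using ((tendsto_pow_atTop_nhds_zero_of_lt_one (r := (1 / 2 : ℝ)) (by norm_num)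
      (by norm_num)).const_mul |B|).mul_const (ω x)
  simpa using ge_of_tendsto' hlim hle

theorem apply_tsum_iterate [LocallyCompactSpace X] (hS : IsWeightedContraction S) (v : C(X, ℂ)) :
    (LinearMap.id - S : C(X, ℂ) →ₗ[ℂ] C(X, ℂ)) (∑' n, (S^[n]) v) = v := by
  have hs := hS.summable_iterate v
  let Sc : C(X, ℂ) →L[ℂ] C(X, ℂ) := ⟨S, hS.continuous⟩
  have h1 : S (∑' n, (S^[n]) v) = ∑' n, (S^[n + 1]) v := by
    simp only [Function.iterate_succ_apply']
    exact Sc.map_tsum hs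
  have h2 := hs.tsum_eq_zero_add
  simp only [LinearMap.sub_apply, LinearMap.id_apply, h1]
  rw [h2]
  simp

theorem norm_tsum_iterate_le [LocallyCompactSpace X] (hS : IsWeightedContraction S)
    {K' : Set X} {ω : X → ℝ}
    (h4 : ∀ u : C(X, ℂ), ∀ C : ℝ, 0 ≤ C →
      (∀ x ∈ K', ‖u x‖ ≤ C * ω x) → ∀ x ∈ K', ‖S u x‖ ≤ C / 2 * ω x)
    (v : C(X, ℂ)) {C : ℝ} (hC : 0 ≤ C) (hv : ∀ x ∈ K', ‖v x‖ ≤ C * ω x) {x : X} (hx : x ∈ K') :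
    ‖(∑' n, (S^[n]) v) x‖ ≤ C * 2 * ω x := by
  rw [← ContinuousMap.tsum_apply (hS.summable_iterate v)]
  refine tsum_of_norm_bounded ((hasSum_geometric_two.mul_left C).mul_right (ω x)) fun n => ?_
  exact norm_iterate_le h4 v hC hv n x hx

/-- If `S` is a weighted contraction, then `1 - S` is an automorphism of `C(X, ℂ)`. -/
noncomputable def oneSubEquiv [LocallyCompactSpace X] (hS : IsWeightedContraction S) :
    C(X, ℂ) ≃L[ℂ] C(X, ℂ) where
  toLinearEquiv := LinearEquiv.ofBijective (LinearMap.id - S)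
    ⟨hS.injective, fun v => ⟨_, hS.apply_tsum_iterate v⟩⟩
  continuous_toFun := continuous_id.sub hS.continuous
  continuous_invFun := by
    let R := (LinearEquiv.ofBijective (LinearMap.id - S)
      ⟨hS.injective, fun v => ⟨_, hS.apply_tsum_iterate v⟩⟩).symm
    change Continuous (R : C(X, ℂ) →ₗ[ℂ] C(X, ℂ))
    -- Continuity of the inverse is read off the Neumann series, whose geometric majorant sums to
    -- `2`.
    have hR : ∀ v, R v = ∑' n, (S^[n]) v := fun v => by
      rw [LinearEquiv.symm_apply_eq]
      exact (hS.apply_tsum_iterate v).symm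
    refine continuous_of_forall_norm_le _ fun K hK => ?_
    obtain ⟨K', h1, h2, ω, W, h3, h4⟩ := hS K hK
    refine ⟨K', h1, 2 * W, fun u B hB hu y hy => ?_⟩
    rw [LinearEquiv.coe_coe, hR]
    refine (hS.norm_tsum_iterate_le h4 u hB (fun x hx => (hu x hx).trans ?_) (h2 hy)).trans ?_
    · nlinarith [(h3 x hx).1]
    · nlinarith [(h3 y (h2 hy)).2]

theorem oneSubEquiv_apply [LocallyCompactSpace X] (hS : IsWeightedContraction S) (u : C(X, ℂ)) :
    hS.oneSubEquiv u = u - S u := rfl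

end IsWeightedContraction

end ContinuousMap

/-! ### Componentwise operators on bicomplex-valued functions. -/

namespace Transmutation

/-- Postcomposition with `Bicomplex.Sc`. -/
noncomputable def scMap {Ω : Set ℂ} (W : C(Ω, Bicomplex)) : C(Ω, ℂ) :=
  ⟨fun ζ => (W ζ).Sc, Bicomplex.continuous_Sc.comp W.continuous⟩

/-- Postcomposition with `Bicomplex.Vec`. -/
noncomputable def vecMap {Ω : Set ℂ} (W : C(Ω, Bicomplex)) : C(Ω, ℂ) :=
  ⟨fun ζ => (W ζ).Vec, Bicomplex.continuous_Vec.comp W.continuous⟩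

theorem continuous_scMap {Ω : Set ℂ} : Continuous (scMap (Ω := Ω)) :=
  ContinuousMap.continuous_postcomp ⟨Bicomplex.Sc, Bicomplex.continuous_Sc⟩

theorem continuous_vecMap {Ω : Set ℂ} : Continuous (vecMap (Ω := Ω)) :=
  ContinuousMap.continuous_postcomp ⟨Bicomplex.Vec, Bicomplex.continuous_Vec⟩

theorem bicomplexOp_apply {Ω : Set ℂ} (A B : C(Ω, ℂ) → C(Ω, ℂ)) (W : C(Ω, Bicomplex)) (z : Ω) :
    bicomplexOp A B W z = ⟨A (scMap W) z, B (vecMap W) z⟩ :=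
  Bicomplex.ofParts_eq _ _

theorem scMap_bicomplexOp {Ω : Set ℂ} (A B : C(Ω, ℂ) → C(Ω, ℂ)) (W : C(Ω, Bicomplex)) :
    scMap (bicomplexOp A B W) = A (scMap W) := by
  ext z
  change (bicomplexOp A B W z).Sc = _
  rw [bicomplexOp_apply]
  rfl

theorem vecMap_bicomplexOp {Ω : Set ℂ} (A B : C(Ω, ℂ) → C(Ω, ℂ)) (W : C(Ω, Bicomplex)) :
    vecMap (bicomplexOp A B W) = B (vecMap W) := by
  ext z
  change (bicomplexOp A B W z).Vec = _
  rw [bicomplexOp_apply]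
  rfl

theorem bicomplex_continuousMap_ext {Ω : Set ℂ} {V W : C(Ω, Bicomplex)} (h₁ : scMap V = scMap W)
    (h₂ : vecMap V = vecMap W) : V = W := by
  ext1 z
  exact QuadraticAlgebra.ext (DFunLike.congr_fun h₁ z) (DFunLike.congr_fun h₂ z)

theorem continuous_prodMk_continuousMap {X Y Z : Type*} [TopologicalSpace X] [UniformSpace Y]
    [UniformSpace Z] :
    Continuous fun p : C(X, Y) × C(X, Z) => ContinuousMap.prodMk p.1 p.2 := by
  rw [continuous_iff_continuousAt]
  rintro ⟨f, g⟩
  rw [ContinuousAt, ContinuousMap.tendsto_iff_forall_isCompact_tendstoUniformlyOn]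
  intro K hK
  have h1 := ContinuousMap.tendsto_iff_forall_isCompact_tendstoUniformlyOn.1
    (continuous_fst.tendsto (f, g)) K hK
  have h2 := ContinuousMap.tendsto_iff_forall_isCompact_tendstoUniformlyOn.1
    (continuous_snd.tendsto (f, g)) K hK
  intro U hU
  exact (h1.prodMk h2 U hU).diag_of_prod

theorem continuous_bicomplexOp {Ω : Set ℂ} {A B : C(Ω, ℂ) → C(Ω, ℂ)} (hA : Continuous A)
    (hB : Continuous B) : Continuous (bicomplexOp A B) :=
  (ContinuousMap.continuous_postcomp ⟨_, Bicomplex.continuous_ofParts⟩).comp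
    (continuous_prodMk_continuousMap.comp
      ((hA.comp continuous_scMap).prodMk (hB.comp continuous_vecMap)))

/-- The automorphism `A Sc + 𝐣 B Vec` of `C(Ω; 𝔹)`, for automorphisms `A` and `B` of `C(Ω)`. -/
noncomputable def bicomplexEquiv {Ω : Set ℂ} (A B : C(Ω, ℂ) ≃L[ℂ] C(Ω, ℂ)) :
    C(Ω, Bicomplex) ≃L[ℂ] C(Ω, Bicomplex) where
  toFun := bicomplexOp A B
  invFun := bicomplexOp A.symm B.symm
  map_add' V W := by
    refine bicomplex_continuousMap_ext ?_ ?_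
    · have h : ∀ V W : C(Ω, Bicomplex), scMap (V + W) = scMap V + scMap W := fun _ _ => rfl
      rw [h, scMap_bicomplexOp, scMap_bicomplexOp, scMap_bicomplexOp, h, map_add]
    · have h : ∀ V W : C(Ω, Bicomplex), vecMap (V + W) = vecMap V + vecMap W := fun _ _ => rfl
      rw [h, vecMap_bicomplexOp, vecMap_bicomplexOp, vecMap_bicomplexOp, h, map_add]
  map_smul' c W := by
    refine bicomplex_continuousMap_ext ?_ ?_
    · have h : ∀ W : C(Ω, Bicomplex), scMap (c • W) = c • scMap W := fun _ => rfl
      rw [RingHom.id_apply, h, scMap_bicomplexOp, scMap_bicomplexOp, h, map_smul]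
    · have h : ∀ W : C(Ω, Bicomplex), vecMap (c • W) = c • vecMap W := fun _ => rfl
      rw [RingHom.id_apply, h, vecMap_bicomplexOp, vecMap_bicomplexOp, h, map_smul]
  left_inv W := bicomplex_continuousMap_ext
    (by rw [scMap_bicomplexOp, scMap_bicomplexOp, A.symm_apply_apply])
    (by rw [vecMap_bicomplexOp, vecMap_bicomplexOp, B.symm_apply_apply])
  right_inv W := bicomplex_continuousMap_ext
    (by rw [scMap_bicomplexOp, scMap_bicomplexOp, A.apply_symm_apply])
    (by rw [vecMap_bicomplexOp, vecMap_bicomplexOp, B.apply_symm_apply])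
  continuous_toFun := continuous_bicomplexOp A.continuous B.continuous
  continuous_invFun := continuous_bicomplexOp A.symm.continuous B.symm.continuous

/-! ### The radial operators as weighted perturbations of the identity. -/

/-- `x ∫₀¹ e^{λ x y} dy ≤ e^{λ x} / λ` for `x ≥ 0`. -/
theorem mul_integral_exp_le {l x : ℝ} (hl : 0 < l) :
    x * ∫ y in (0 : ℝ)..1, Real.exp (l * x * y) ≤ Real.exp (l * x) / l := by
  rcases eq_or_ne x 0 with rfl | hx
  · simp only [zero_mul]
    positivity
  · rw [intervalIntegral.integral_comp_mul_left (fun y => Real.exp y) (mul_ne_zero hl.ne' hx),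
      integral_exp, smul_eq_mul, mul_zero, mul_one, Real.exp_zero, mul_inv, ← mul_assoc,
      mul_comm x, mul_assoc l⁻¹, inv_mul_cancel₀ hx, mul_one, div_eq_inv_mul]
    gcongr
    linarith

theorem integral_mul_comp_sq {f : ℝ → ℝ} (hf : Continuous f) :
    ∫ σ in (0 : ℝ)..1, σ * f (σ ^ 2) = (∫ s in (0 : ℝ)..1, f s) / 2 := by
  have h := intervalIntegral.integral_comp_mul_deriv (a := 0) (b := 1) (f := fun σ : ℝ => σ ^ 2)
    (f' := fun σ => 2 * σ) (g := f) (fun x _ => by simpa using hasDerivAt_pow 2 x)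
    (by fun_prop) hf
  simp only [Function.comp_def] at h
  rw [show (0 : ℝ) ^ 2 = 0 by norm_num, show (1 : ℝ) ^ 2 = 1 by norm_num] at h
  rw [← h, ← intervalIntegral.integral_div]
  congr 1
  funext σ
  ring

section RadialOperator

variable {Ω : Set ℂ} {q : ℝ → ℂ} {G : ℝ → ℝ → ℂ}

/-- `(𝐓 u - u)(z)` as an integral with a continuous integrand. -/
theorem radialOp_sub_apply (hs : StarConvex ℝ 0 Ω) (hb : Bornology.IsBounded Ω)
    (hG : IsKernel (outerRadius Ω) q G) (u : C(Ω, ℂ)) (z : Ω) :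
    (radialOp hs hb hG u - u) z = ∫ σ in (0 : ℝ)..1, (σ : ℂ) *
      G ‖(z : ℂ)‖ (1 - ((projIcc (0 : ℝ) 1 zero_le_one σ : Icc (0 : ℝ) 1) : ℝ) ^ 2) *
        u ⟨(((projIcc (0 : ℝ) 1 zero_le_one σ : Icc (0 : ℝ) 1) : ℝ) : ℂ) ^ 2 * (z : ℂ),
          sq_mul_mem hs z.2 (projIcc (0 : ℝ) 1 zero_le_one σ).2⟩ := by
  rw [ContinuousMap.sub_apply]
  change radialFun Ω G u z - u z = _
  rw [radialFun, add_sub_cancel_left]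
  refine intervalIntegral.integral_congr fun σ hσ => ?_
  rw [uIcc_of_le zero_le_one] at hσ
  have hcσ : ((projIcc (0 : ℝ) 1 zero_le_one σ : Icc (0 : ℝ) 1) : ℝ) = σ :=
    congrArg Subtype.val (projIcc_of_mem zero_le_one hσ)
  simp only [hcσ, dif_pos (sq_mul_mem hs z.2 hσ)]

theorem continuous_radialIntegrand (hs : StarConvex ℝ 0 Ω) (hb : Bornology.IsBounded Ω)
    (hG : IsKernel (outerRadius Ω) q G) (u : C(Ω, ℂ)) (z : Ω) :
    Continuous fun σ : ℝ => (σ : ℂ) *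
      G ‖(z : ℂ)‖ (1 - ((projIcc (0 : ℝ) 1 zero_le_one σ : Icc (0 : ℝ) 1) : ℝ) ^ 2) *
        u ⟨(((projIcc (0 : ℝ) 1 zero_le_one σ : Icc (0 : ℝ) 1) : ℝ) : ℂ) ^ 2 * (z : ℂ),
          sq_mul_mem hs z.2 (projIcc (0 : ℝ) 1 zero_le_one σ).2⟩ := by
  have hc : Continuous fun σ : ℝ => ((projIcc (0 : ℝ) 1 zero_le_one σ : Icc (0 : ℝ) 1) : ℝ) :=
    continuous_subtype_val.comp continuous_projIcc
  refine (Complex.continuous_ofReal.mul ?_).mul (u.continuous.comp (Continuous.subtype_mk ?_ _))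
  · refine hG.continuousOn.comp_continuous (f := fun σ : ℝ => (‖(z : ℂ)‖,
      1 - ((projIcc (0 : ℝ) 1 zero_le_one σ : Icc (0 : ℝ) 1) : ℝ) ^ 2)) (by fun_prop) fun σ => ?_
    have := (projIcc (0 : ℝ) 1 zero_le_one σ).2
    refine ⟨norm_mem_Icc hb z.2, ?_, ?_⟩
    · have := pow_le_one₀ (n := 2) this.1 this.2
      simp only
      linarith
    · simp only
      nlinarith [this.1]
  · fun_prop

/-- `u ↦ u - 𝐓 u` as a linear map. -/
noncomputable def radialLinear (hs : StarConvex ℝ 0 Ω) (hb : Bornology.IsBounded Ω)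
    (hG : IsKernel (outerRadius Ω) q G) : C(Ω, ℂ) →ₗ[ℂ] C(Ω, ℂ) where
  toFun u := u - radialOp hs hb hG u
  map_add' u v := by
    rw [← neg_inj, neg_add, neg_sub, neg_sub, neg_sub]
    ext z
    rw [ContinuousMap.add_apply]
    simp only [radialOp_sub_apply]
    rw [← intervalIntegral.integral_add]
    · congr 1
      funext σ
      simp only [ContinuousMap.add_apply]
      ring
    · exact (continuous_radialIntegrand hs hb hG u z).intervalIntegrable _ _
    · exact (continuous_radialIntegrand hs hb hG v z).intervalIntegrable _ _
  map_smul' c u := by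
    rw [← neg_inj, ← smul_neg, neg_sub, neg_sub]
    ext z
    rw [ContinuousMap.smul_apply]
    simp only [radialOp_sub_apply]
    rw [RingHom.id_apply, ← intervalIntegral.integral_smul]
    congr 1
    funext σ
    simp only [ContinuousMap.smul_apply, smul_eq_mul]
    ring

/-- The substitution `s = σ²` turns `σ dσ` into `ds / 2`, the source of the factor `1/2`. Only the
values of `u` on the segment `[0, z]` enter. -/
theorem norm_radialLinear_le (hs : StarConvex ℝ 0 Ω) (hb : Bornology.IsBounded Ω)
    (hG : IsKernel (outerRadius Ω) q G) (u : C(Ω, ℂ)) (z : Ω) {m l C : ℝ} (hm : 0 ≤ m)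
    (hGm : ∀ t ∈ Icc (0 : ℝ) 1, ‖G ‖(z : ℂ)‖ t‖ ≤ m)
    (hu : ∀ w : Ω, (∃ s ∈ Icc (0 : ℝ) 1, (w : ℂ) = s * z) → ‖u w‖ ≤ C * Real.exp (l * ‖(w : ℂ)‖)) :
    ‖radialLinear hs hb hG u z‖ ≤
      m * C / 2 * ∫ s in (0 : ℝ)..1, Real.exp (l * ‖(z : ℂ)‖ * s) := by
  have h0 : ‖radialLinear hs hb hG u z‖ = ‖(radialOp hs hb hG u - u) z‖ := by
    rw [← norm_neg]
    congr 1
    change -((u - radialOp hs hb hG u) z) = _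
    simp
  rw [h0, radialOp_sub_apply]
  have h1 : m * C / 2 * ∫ s in (0 : ℝ)..1, Real.exp (l * ‖(z : ℂ)‖ * s) =
      ∫ σ in (0 : ℝ)..1, σ * (m * C * Real.exp (l * ‖(z : ℂ)‖ * σ ^ 2)) := by
    rw [integral_mul_comp_sq (f := fun s => m * C * Real.exp (l * ‖(z : ℂ)‖ * s))
      (by fun_prop), intervalIntegral.integral_const_mul]
    ring
  rw [h1]
  refine intervalIntegral.norm_integral_le_of_norm_le zero_le_one ?_
    (Continuous.intervalIntegrable (by fun_prop) _ _)
  refine Filter.Eventually.of_forall fun σ hσ => ?_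
  have hσ' : σ ∈ Icc (0 : ℝ) 1 := Ioc_subset_Icc_self hσ
  have hcσ : ((projIcc (0 : ℝ) 1 zero_le_one σ : Icc (0 : ℝ) 1) : ℝ) = σ :=
    congrArg Subtype.val (projIcc_of_mem zero_le_one hσ')
  simp only [hcσ]
  have h2 := pow_le_one₀ (n := 2) hσ'.1 hσ'.2
  have h3 := sq_nonneg σ
  rw [norm_mul, norm_mul, Complex.norm_real, Real.norm_of_nonneg hσ'.1, mul_assoc, mul_assoc m]
  refine mul_le_mul_of_nonneg_left ?_ hσ'.1
  refine mul_le_mul (hGm _ ⟨by linarith, by linarith⟩) ?_ (norm_nonneg _) hm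
  refine (hu _ ⟨σ ^ 2, ⟨h3, h2⟩, by push_cast; rfl⟩).trans (le_of_eq ?_)
  simp only [norm_mul, norm_pow, Complex.norm_real, Real.norm_of_nonneg hσ'.1]
  ring_nf

/-- Compare `(r, t)` with `(0, t)`, where the kernel vanishes, by uniform continuity on the compact
rectangle. -/
theorem exists_norm_kernel_le_one {ϱ : ℝ} (hG : IsKernel ϱ q G) :
    ∃ δ > 0, ∀ r ∈ Icc 0 ϱ, r < δ → ∀ t ∈ Icc (0 : ℝ) 1, ‖G r t‖ ≤ 1 := by
  have h := (isCompact_Icc.prod isCompact_Icc).uniformContinuousOn_of_continuous hG.continuousOn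
  rw [Metric.uniformContinuousOn_iff] at h
  obtain ⟨δ, hδ, h⟩ := h 1 one_pos
  refine ⟨δ, hδ, fun r hr hrδ t ht => ?_⟩
  have h1 := h (r, t) ⟨hr, ht⟩ (0, t) ⟨⟨le_rfl, hr.1.trans hr.2⟩, ht⟩ (by
    rw [Prod.dist_eq, dist_self, Real.dist_eq, sub_zero, abs_of_nonneg hr.1]
    exact max_lt hrδ hδ)
  simpa [hG.boundary t ht] using h1.le

theorem isWeightedContraction_radialLinear (hs : StarConvex ℝ 0 Ω) (hb : Bornology.IsBounded Ω)
    (hG : IsKernel (outerRadius Ω) q G) :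
    ContinuousMap.IsWeightedContraction (radialLinear hs hb hG) := by
  obtain ⟨δ, hδ, hGδ⟩ := exists_norm_kernel_le_one hG
  obtain ⟨M₀, hM₀⟩ := (isCompact_Icc.prod isCompact_Icc).exists_bound_of_continuousOn
    hG.continuousOn
  set M := |M₀| + 1 with hM
  have hMpos : 0 < M := by positivity
  have hGM : ∀ r ∈ Icc 0 (outerRadius Ω), ∀ t ∈ Icc (0 : ℝ) 1, ‖G r t‖ ≤ M := fun r hr t ht =>
    (hM₀ (r, t) ⟨hr, ht⟩).trans (by linarith [le_abs_self M₀])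
  -- For `|z| ≥ δ` the exponential integral is at most `exp (l |z|) / (l δ)`; this `l` makes `l δ =
  -- M`, cancelling the bound on the kernel.
  set l := M / δ with hl
  have hlpos : 0 < l := by positivity
  intro K hK
  -- The image of `φ` on `[0, 1] × K` is the radial hull of `K`: compact, and closed under the
  -- contractions `z ↦ s z` that `S` uses.
  let φ : Icc (0 : ℝ) 1 × Ω → Ω := fun p =>
    ⟨(p.1 : ℝ) * (p.2 : ℂ), by
      simpa [Complex.real_smul] using hs.smul_mem p.2.2 p.1.2.1 p.1.2.2⟩
  have hφ : Continuous φ := by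
    refine Continuous.subtype_mk ?_ _
    fun_prop
  refine ⟨φ '' (univ ×ˢ K), (isCompact_univ.prod hK).image hφ, fun z hz => ?_,
    fun z => Real.exp (l * ‖(z : ℂ)‖), Real.exp (l * outerRadius Ω), fun z _ => ⟨?_, ?_⟩, ?_⟩
  · refine ⟨(⟨1, by simp⟩, z), ⟨mem_univ _, hz⟩, ?_⟩
    simp [φ]
  · exact Real.one_le_exp (by positivity)
  · exact Real.exp_le_exp.2 (mul_le_mul_of_nonneg_left (norm_mem_Icc hb z.2).2 hlpos.le)
  · rintro u C hC hu _ ⟨⟨θ, z⟩, ⟨-, hz⟩, rfl⟩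
    generalize hw : φ (θ, z) = w
    have huw : ∀ v : Ω, (∃ s ∈ Icc (0 : ℝ) 1, (v : ℂ) = s * w) →
        ‖u v‖ ≤ C * Real.exp (l * ‖(v : ℂ)‖) := by
      rintro v ⟨s, hs', hv⟩
      refine hu v ⟨(⟨s * θ, mul_nonneg hs'.1 θ.2.1, mul_le_one₀ hs'.2 θ.2.1 θ.2.2⟩, z),
        ⟨mem_univ _, hz⟩, ?_⟩
      ext1
      rw [hv, ← hw]
      simp [φ, mul_assoc]
    have hwr := norm_mem_Icc hb w.2
    -- Near the origin the exponential brings no gain, and the factor `1/2` with `|G| ≤ 1` suffices;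
    -- elsewhere `l` compensates for `M`.
    rcases lt_or_ge ‖(w : ℂ)‖ δ with hlt | hge
    · refine (norm_radialLinear_le hs hb hG u w zero_le_one (hGδ _ hwr hlt) huw).trans ?_
      rw [one_mul]
      refine mul_le_mul_of_nonneg_left ?_ (by positivity)
      have : ∫ s in (0 : ℝ)..1, Real.exp (l * ‖(w : ℂ)‖ * s) ≤
          ∫ s in (0 : ℝ)..1, Real.exp (l * ‖(w : ℂ)‖) := by
        refine intervalIntegral.integral_mono_on zero_le_one
          (Continuous.intervalIntegrable (by fun_prop) _ _)
          (Continuous.intervalIntegrable (by fun_prop) _ _) fun s hs' => ?_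
        rw [Real.exp_le_exp]
        exact mul_le_of_le_one_right (by positivity) hs'.2
      simpa using this
    · refine (norm_radialLinear_le hs hb hG u w hMpos.le (hGM _ hwr) huw).trans ?_
      have h1 := mul_integral_exp_le (x := ‖(w : ℂ)‖) hlpos
      set I := ∫ s in (0 : ℝ)..1, Real.exp (l * ‖(w : ℂ)‖ * s) with hI
      have hI0 : 0 ≤ I := intervalIntegral.integral_nonneg zero_le_one fun s _ => (Real.exp_pos _).le
      have h2 : δ * I ≤ Real.exp (l * ‖(w : ℂ)‖) / l :=
        (mul_le_mul_of_nonneg_right hge hI0).trans h1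
      have h3 : M * I ≤ Real.exp (l * ‖(w : ℂ)‖) := by
        rw [le_div_iff₀ hlpos] at h2
        have h4 : δ * I * l = M * I := by
          rw [hl]
          field_simp
        linarith
      calc M * C / 2 * I = C / 2 * (M * I) := by ring
        _ ≤ _ := mul_le_mul_of_nonneg_left h3 (by positivity)

/-- The operator `radialOp` as an automorphism of `C(Ω)`. -/
noncomputable def radialEquiv (hΩ : IsOpen Ω) (hs : StarConvex ℝ 0 Ω) (hb : Bornology.IsBounded Ω)
    (hG : IsKernel (outerRadius Ω) q G) : C(Ω, ℂ) ≃L[ℂ] C(Ω, ℂ) :=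
  haveI : LocallyCompactSpace Ω := hΩ.locallyCompactSpace
  (isWeightedContraction_radialLinear hs hb hG).oneSubEquiv

theorem coe_radialEquiv (hΩ : IsOpen Ω) (hs : StarConvex ℝ 0 Ω) (hb : Bornology.IsBounded Ω)
    (hG : IsKernel (outerRadius Ω) q G) : ⇑(radialEquiv hΩ hs hb hG) = radialOp hs hb hG := by
  funext u
  exact sub_sub_cancel u (radialOp hs hb hG u)

end RadialOperator

end Transmutation

/-! ### Regularity of solutions of the Goursat integral equation. -/

namespace Transmutation

theorem contDiff_one_parametric_integral {F : (ℝ × ℝ) → ℝ → ℂ}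
    (hF : ContDiff ℝ 1 fun p : (ℝ × ℝ) × ℝ => F p.1 p.2) (a b : ℝ) :
    ContDiff ℝ 1 fun x => ∫ t in a..b, F x t := by
  set Φ : (ℝ × ℝ) × ℝ → ℂ := fun p => F p.1 p.2 with hΦ
  let F' : (ℝ × ℝ) → ℝ → (ℝ × ℝ) →L[ℝ] ℂ := fun x t =>
    (fderiv ℝ Φ (x, t)).comp (ContinuousLinearMap.inl ℝ (ℝ × ℝ) ℝ)
  have hF'c : Continuous fun p : (ℝ × ℝ) × ℝ => F' p.1 p.2 :=
    (hF.continuous_fderiv one_ne_zero).clm_comp continuous_const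
  rw [contDiff_one_iff_hasFDerivAt]
  refine ⟨fun x => ∫ t in a..b, F' x t,
    intervalIntegral.continuous_parametric_intervalIntegral_of_continuous' hF'c a b, fun x₀ => ?_⟩
  obtain ⟨B, hB⟩ := ((isCompact_closedBall x₀ 1).prod
    (isCompact_uIcc (a := a) (b := b))).exists_bound_of_continuousOn hF'c.continuousOn
  refine intervalIntegral.hasFDerivAt_integral_of_dominated_of_fderiv_le
    (F := F) (F' := F') (bound := fun _ => B) (Metric.closedBall_mem_nhds x₀ one_pos)
    (Filter.Eventually.of_forall fun x => ?_) ?_ ?_ ?_ ?_ ?_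
  · exact (hF.continuous.comp (Continuous.prodMk_right x)).aestronglyMeasurable
  · exact (hF.continuous.comp (Continuous.prodMk_right x₀)).intervalIntegrable _ _
  · exact (hF'c.comp (Continuous.prodMk_right x₀)).aestronglyMeasurable
  · exact Filter.Eventually.of_forall fun t ht x hx => hB (x, t) ⟨hx, uIoc_subset_uIcc ht⟩
  · exact intervalIntegrable_const
  · refine Filter.Eventually.of_forall fun t _ x _ => ?_
    have h1 : HasFDerivAt Φ (fderiv ℝ Φ (x, t)) (x, t) :=
      (hF.differentiable one_ne_zero (x, t)).hasFDerivAt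
    exact HasFDerivAt.comp (f := fun e : ℝ × ℝ => (e, t)) x h1 (hasFDerivAt_prodMk_left x t)

/-- Rescaling `η = p.2 θ` fixes the limits of integration, leaving differentiation under the
integral sign. -/
theorem contDiff_one_parametric_primitive {W : ℝ × ℝ → ℂ} (hW : ContDiff ℝ 1 W) :
    ContDiff ℝ 1 fun p : ℝ × ℝ => ∫ η in (0 : ℝ)..p.2, W (p.1, η) := by
  have h : (fun p : ℝ × ℝ => ∫ η in (0 : ℝ)..p.2, W (p.1, η)) =
      fun p : ℝ × ℝ => p.2 • ∫ θ in (0 : ℝ)..1, W (p.1, p.2 * θ) := by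
    funext p
    rw [intervalIntegral.smul_integral_comp_mul_left (fun η => W (p.1, η))]
    simp
  rw [h]
  refine contDiff_snd.smul (contDiff_one_parametric_integral
    (F := fun p θ => W (p.1, p.2 * θ)) ?_ 0 1)
  fun_prop

theorem contDiff_of_hasDerivAt_partials {n : ℕ} {M A B : ℝ × ℝ → ℂ} (hA : ContDiff ℝ n A)
    (hB : ContDiff ℝ n B) (hMA : ∀ p t, HasDerivAt (fun s => M (s, t)) (A (p, t)) p)
    (hMB : ∀ p t, HasDerivAt (fun s => M (p, s)) (B (p, t)) t) :
    ContDiff ℝ (n + 1) M := by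
  -- `D c` is the real-linear map `s ↦ s c`, so that `D (A x)` and `D (B x)` assemble into the total
  -- derivative.
  let D : ℂ →L[ℝ] ℝ →L[ℝ] ℂ := (ContinuousLinearMap.smulRightL ℝ ℝ ℂ (1 : ℝ →L[ℝ] ℝ))
  have hD : ∀ c, D c = ContinuousLinearMap.toSpanSingleton ℝ c := by
    intro c
    ext
    simp [D]
  rw [contDiff_succ_iff_hasFDerivAt]
  refine ⟨fun x => (D (A x)).coprod (D (B x)), ?_, fun x => ?_⟩
  · have hAD : ContDiff ℝ n fun x => (D (A x)).comp (ContinuousLinearMap.fst ℝ ℝ ℝ) :=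
      (D.contDiff.comp hA).clm_comp contDiff_const
    have hBD : ContDiff ℝ n fun x => (D (B x)).comp (ContinuousLinearMap.snd ℝ ℝ ℝ) :=
      (D.contDiff.comp hB).clm_comp contDiff_const
    exact hAD.add hBD
  · refine (hasStrictFDerivAt_uncurry_coprod (𝕜 := ℝ) (u := x) (f := fun a b => M (a, b))
      (f₁ := fun a b => D (A (a, b))) (f₂ := fun a b => D (B (a, b)))
      (Filter.Eventually.of_forall fun v => ?_) (Filter.Eventually.of_forall fun v => ?_)
      ?_ ?_).hasFDerivAt
    · have := (hMA v.1 v.2).hasFDerivAt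
      rwa [← hD] at this
    · have := (hMB v.1 v.2).hasFDerivAt
      rwa [← hD] at this
    · exact (D.continuous.comp hA.continuous).continuousAt
    · exact (D.continuous.comp hB.continuous).continuousAt

section Goursat

variable {φ : ℝ → ℂ} {V M : ℝ × ℝ → ℂ}

/-- The first partial derivative of a solution of the Goursat problem. -/
noncomputable def goursatDeriv (φ : ℝ → ℂ) (V M : ℝ × ℝ → ℂ) (p : ℝ × ℝ) : ℂ :=
  φ p.1 + ∫ η in (0 : ℝ)..p.2, V (p.1, η) * M (p.1, η)

theorem continuous_goursatDeriv (hφ : Continuous φ) (hV : Continuous V) (hM : Continuous M) :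
    Continuous (goursatDeriv φ V M) := by
  unfold goursatDeriv
  fun_prop

theorem contDiff_goursatDeriv (hφ : ContDiff ℝ 1 φ) (hV : ContDiff ℝ 1 V) (hM : ContDiff ℝ 1 M) :
    ContDiff ℝ 1 (goursatDeriv φ V M) :=
  (hφ.comp contDiff_fst).add (contDiff_one_parametric_primitive (hV.mul hM))

theorem hasDerivAt_goursatDeriv_snd (hV : Continuous V) (hM : Continuous M) (p t : ℝ) :
    HasDerivAt (fun τ => goursatDeriv φ V M (p, τ)) (V (p, t) * M (p, t)) t := by
  have hc : Continuous fun η => V (p, η) * M (p, η) := by fun_prop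
  exact ((hc.integral_hasStrictDerivAt 0 t).hasDerivAt).const_add (φ p)

theorem hasDerivAt_goursat_fst (hφ : Continuous φ) (hV : Continuous V) (hM : Continuous M)
    (hE : ∀ p t, M (p, t) = ∫ s in (0 : ℝ)..p, goursatDeriv φ V M (s, t)) (p t : ℝ) :
    HasDerivAt (fun s => M (s, t)) (goursatDeriv φ V M (p, t)) p := by
  have hc : Continuous fun s => goursatDeriv φ V M (s, t) :=
    (continuous_goursatDeriv hφ hV hM).comp (Continuous.prodMk_left t)
  simp only [hE]
  exact (hc.integral_hasStrictDerivAt _ _).hasDerivAt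

/-- Fubini moves the second variable to the outer integral, where the fundamental theorem of
calculus applies. -/
theorem hasDerivAt_goursat_snd (hφ : Continuous φ) (hV : Continuous V) (hM : Continuous M)
    (hE : ∀ p t, M (p, t) = ∫ s in (0 : ℝ)..p, goursatDeriv φ V M (s, t)) (p t : ℝ) :
    HasDerivAt (fun τ => M (p, τ)) (∫ s in (0 : ℝ)..p, V (s, t) * M (s, t)) t := by
  have hVM : Continuous fun x : ℝ × ℝ => V x * M x := hV.mul hM
  have h1 : ∀ τ, M (p, τ) = (∫ s in (0 : ℝ)..p, φ s) +
      ∫ η in (0 : ℝ)..τ, ∫ s in (0 : ℝ)..p, V (s, η) * M (s, η) := by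
    intro τ
    rw [hE]
    unfold goursatDeriv
    rw [intervalIntegral.integral_add (hφ.intervalIntegrable _ _)
      (Continuous.intervalIntegrable (by fun_prop) _ _)]
    congr 1
    refine MeasureTheory.intervalIntegral_intervalIntegral_swap ?_
    exact (hVM.continuousOn.integrableOn_compact (isCompact_uIcc.prod isCompact_uIcc)).mono_set
      (prod_mono uIoc_subset_uIcc uIoc_subset_uIcc)
  simp only [h1]
  have hc : Continuous fun η => ∫ s in (0 : ℝ)..p, V (s, η) * M (s, η) :=
    intervalIntegral.continuous_parametric_intervalIntegral_of_continuous'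
      (f := fun η s => V (s, η) * M (s, η)) (by fun_prop) _ _
  exact (hc.integral_hasStrictDerivAt _ _).hasDerivAt.const_add _

/-- Bootstrapping: both partial derivatives are integrals involving `M`, so they are continuous when
`M` is, and `C¹` once `M` is `C¹`. -/
theorem contDiff_two_goursat (hφ : ContDiff ℝ 1 φ) (hV : ContDiff ℝ 1 V) (hM : Continuous M)
    (hE : ∀ p t, M (p, t) = ∫ s in (0 : ℝ)..p, goursatDeriv φ V M (s, t)) :
    ContDiff ℝ 2 M := by
  have hA := hasDerivAt_goursat_fst hφ.continuous hV.continuous hM hE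
  have hB := hasDerivAt_goursat_snd hφ.continuous hV.continuous hM hE
  have hVc := hV.continuous
  have hM1 : ContDiff ℝ 1 M := by
    have := contDiff_of_hasDerivAt_partials (n := 0) (M := M)
      (A := goursatDeriv φ V M) (B := fun x => ∫ s in (0 : ℝ)..x.1, V (s, x.2) * M (s, x.2))
      (contDiff_zero.2 (continuous_goursatDeriv hφ.continuous hV.continuous hM))
      (contDiff_zero.2 (by fun_prop)) hA hB
    simpa using this
  have hM2 := contDiff_of_hasDerivAt_partials (n := 1) (M := M)
      (A := goursatDeriv φ V M) (B := fun x => ∫ s in (0 : ℝ)..x.1, V (s, x.2) * M (s, x.2))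
      (contDiff_goursatDeriv hφ hV hM1) ?_ hA hB
  · exact hM2
  · exact (contDiff_one_parametric_primitive (W := fun x => V (x.2, x.1) * M (x.2, x.1))
      (by fun_prop)).comp (contDiff_snd.prodMk contDiff_fst)

end Goursat
end Transmutation

/-! ### The Volterra equation for the kernel divided by `r²`. -/

namespace Transmutation

/-- The quotient `|a| / |x|` has no limit at `a = x = 0`. The cutoff `1 + |a|` keeps the argument of
`k` bounded there, and the factor `x` then gives the limit `0`. -/
theorem continuous_mul_comp_min_div {k : ℝ × ℝ → ℂ} (hk : Continuous k) :
    Continuous fun p : (ℝ × ℝ) × ℝ =>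
      (p.2 : ℂ) * k (p.1.1, min (|p.1.2| / |p.2|) (1 + |p.1.2|)) := by
  rw [continuous_iff_continuousAt]
  rintro ⟨⟨ρ, a⟩, x⟩
  rcases eq_or_ne x 0 with rfl | hx
  · obtain ⟨B, hB⟩ := ((isCompact_closedBall ρ 1).prod
      (isCompact_Icc (a := 0) (b := 2 + |a|))).exists_bound_of_continuousOn hk.continuousOn
    have h0 : Filter.Tendsto (fun p : (ℝ × ℝ) × ℝ => |p.2| * B) (𝓝 ((ρ, a), 0)) (𝓝 0) := by
      have : Continuous fun p : (ℝ × ℝ) × ℝ => |p.2| * B := by fun_prop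
      simpa using this.tendsto ((ρ, a), 0)
    rw [ContinuousAt, Complex.ofReal_zero, zero_mul]
    refine squeeze_zero_norm' ?_ h0
    have h1 : ∀ᶠ p : (ℝ × ℝ) × ℝ in 𝓝 ((ρ, a), 0), p.1 ∈ Metric.closedBall (ρ, a) 1 :=
      continuous_fst.continuousAt.preimage_mem_nhds (Metric.closedBall_mem_nhds _ one_pos)
    filter_upwards [h1] with p hp
    rw [Metric.mem_closedBall, Prod.dist_eq, max_le_iff] at hp
    rw [norm_mul, Complex.norm_real, Real.norm_eq_abs]
    refine mul_le_mul_of_nonneg_left (hB _ ⟨hp.1, le_min (by positivity) (by positivity), ?_⟩)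
      (abs_nonneg _)
    refine (min_le_right _ _).trans ?_
    have h2 := hp.2
    rw [Real.dist_eq] at h2
    have := abs_sub_abs_le_abs_sub p.1.2 a
    simp only at h2 ⊢
    linarith
  · have hd : ContinuousAt (fun p : (ℝ × ℝ) × ℝ =>
        (p.1.1, min (|p.1.2| / |p.2|) (1 + |p.1.2|))) ((ρ, a), x) := by
      have : ContinuousAt (fun p : (ℝ × ℝ) × ℝ => |p.1.2| / |p.2|) ((ρ, a), x) :=
        ContinuousAt.div (by fun_prop) (by fun_prop) (by simpa using hx)
      fun_prop
    exact ContinuousAt.mul (by fun_prop)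
      (ContinuousAt.comp (g := k) hk.continuousAt hd)

/-- The integrand of `kernelOp`. -/
noncomputable def kernelIntegrand (q : ℝ → ℂ) (k : ℝ × ℝ → ℂ) (s a x : ℝ) : ℂ :=
  q (s * x) * ((x : ℂ) * k (s * x, min (|a| / |x|) (1 + |a|)))

theorem continuous_kernelIntegrand {q : ℝ → ℂ} (hq : Continuous q) {k : ℝ × ℝ → ℂ}
    (hk : Continuous k) :
    Continuous fun p : (ℝ × ℝ) × ℝ => kernelIntegrand q k p.1.1 p.1.2 p.2 := by
  unfold kernelIntegrand
  refine Continuous.mul (by fun_prop) ?_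
  exact (continuous_mul_comp_min_div hk).comp
    (f := fun p : (ℝ × ℝ) × ℝ => ((p.1.1 * p.2, p.1.2), p.2)) (by fun_prop)

/-- On the range of integration the cutoff is inactive, also when `|a| > 1` and the interval is
reversed. -/
theorem pos_and_div_le_of_mem_uIoc {a x : ℝ} (hx : x ∈ uIoc |a| 1) :
    0 < x ∧ x ≤ max 1 |a| ∧ |a| / |x| ≤ max 1 |a| ∧
      min (|a| / |x|) (1 + |a|) = |a| / x := by
  rw [mem_uIoc] at hx
  have ha := abs_nonneg a
  have hpos : 0 < x := by
    rcases hx with h | h <;> linarith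
  have hle : |a| / |x| ≤ max 1 |a| := by
    rw [abs_of_pos hpos, div_le_iff₀ hpos]
    rcases hx with h | h
    · nlinarith [le_max_left 1 |a|]
    · nlinarith [le_max_right 1 |a|]
  refine ⟨hpos, ?_, hle, ?_⟩
  · rcases hx with h | h
    · exact h.2.trans (le_max_left _ _)
    · exact h.2.trans (le_max_right _ _)
  · rw [min_eq_left, abs_of_pos hpos]
    exact hle.trans (max_le (by linarith) (by linarith))

theorem continuous_kernelOp {q : ℝ → ℂ} (hq : Continuous q) {k : ℝ × ℝ → ℂ} (hk : Continuous k) :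
    Continuous fun p : ℝ × ℝ => (p.1 : ℂ) ^ 2 * ∫ y in (0 : ℝ)..1, (y : ℂ) ^ 3 *
      ∫ x in |p.2|..1, kernelIntegrand q k (p.1 * y) p.2 x := by
  have h : Continuous fun p : (ℝ × ℝ) × ℝ =>
      ∫ x in |p.1.2|..1, kernelIntegrand q k (p.1.1 * p.2) p.1.2 x := by
    have hsymm : (fun p : (ℝ × ℝ) × ℝ =>
        ∫ x in |p.1.2|..1, kernelIntegrand q k (p.1.1 * p.2) p.1.2 x) = fun p : (ℝ × ℝ) × ℝ =>
        -∫ x in (1 : ℝ)..|p.1.2|, kernelIntegrand q k (p.1.1 * p.2) p.1.2 x :=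
      funext fun p => intervalIntegral.integral_symm _ _
    rw [hsymm]
    refine Continuous.neg
      (intervalIntegral.continuous_parametric_intervalIntegral_of_continuous
        (f := fun (p : (ℝ × ℝ) × ℝ) x => kernelIntegrand q k (p.1.1 * p.2) p.1.2 x) ?_ ?_)
    · exact (continuous_kernelIntegrand hq hk).comp
        (f := fun p : ((ℝ × ℝ) × ℝ) × ℝ => ((p.1.1.1 * p.1.2, p.1.1.2), p.2)) (by fun_prop)
    · fun_prop
  refine Continuous.mul (by fun_prop) ?_
  exact intervalIntegral.continuous_parametric_intervalIntegral_of_continuous'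
    (f := fun (p : ℝ × ℝ) y => (y : ℂ) ^ 3 *
      ∫ x in |p.2|..1, kernelIntegrand q k (p.1 * y) p.2 x)
    (Continuous.mul (by fun_prop) h) 0 1

theorem continuous_kernelOp_inner {q : ℝ → ℂ} (hq : Continuous q) {k : ℝ × ℝ → ℂ}
    (hk : Continuous k) (r a : ℝ) :
    Continuous fun y : ℝ => ∫ x in |a|..1, kernelIntegrand q k (r * y) a x :=
  intervalIntegral.continuous_parametric_intervalIntegral_of_continuous'
    (f := fun (y : ℝ) x => kernelIntegrand q k (r * y) a x)
    ((continuous_kernelIntegrand hq hk).comp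
      (f := fun p : ℝ × ℝ => ((r * p.1, a), p.2)) (by fun_prop)) _ _

/-- The Volterra operator
`k ↦ r² ∫₀¹ y³ ∫_{|a|}¹ x q(r y x) k(r y x, |a| / x) dx dy`. -/
noncomputable def kernelOp {q : ℝ → ℂ} (hq : Continuous q) : C(ℝ × ℝ, ℂ) →ₗ[ℂ] C(ℝ × ℝ, ℂ) where
  toFun k := ⟨_, continuous_kernelOp hq k.continuous⟩
  map_add' k l := by
    ext ⟨r, a⟩
    simp only [ContinuousMap.coe_mk, ContinuousMap.add_apply]
    have hc : ∀ (m : C(ℝ × ℝ, ℂ)) (s : ℝ), Continuous (kernelIntegrand q m s a) := fun m s =>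
      (continuous_kernelIntegrand hq m.continuous).comp (Continuous.prodMk_right (s, a))
    rw [← mul_add, ← intervalIntegral.integral_add]
    · congr 2
      funext y
      rw [← mul_add, ← intervalIntegral.integral_add ((hc k _).intervalIntegrable _ _)
        ((hc l _).intervalIntegrable _ _)]
      congr 2
      funext x
      simp only [kernelIntegrand, ContinuousMap.add_apply]
      ring
    · exact (Continuous.mul (by fun_prop)
        (continuous_kernelOp_inner hq k.continuous r a)).intervalIntegrable _ _
    · exact (Continuous.mul (by fun_prop)
        (continuous_kernelOp_inner hq l.continuous r a)).intervalIntegrable _ _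
  map_smul' c k := by
    ext ⟨r, a⟩
    simp only [ContinuousMap.coe_mk, ContinuousMap.smul_apply, RingHom.id_apply, smul_eq_mul]
    rw [mul_left_comm, ← intervalIntegral.integral_const_mul c]
    congr 2
    funext y
    rw [mul_left_comm, ← intervalIntegral.integral_const_mul c]
    congr 2
    funext x
    simp only [kernelIntegrand, ContinuousMap.smul_apply, smul_eq_mul]
    ring

theorem kernelOp_apply {q : ℝ → ℂ} (hq : Continuous q) (k : C(ℝ × ℝ, ℂ)) (r a : ℝ) :
    kernelOp hq k (r, a) = (r : ℂ) ^ 2 * ∫ y in (0 : ℝ)..1, (y : ℂ) ^ 3 *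
      ∫ x in |a|..1, kernelIntegrand q k (r * y) a x := rfl

/-- The Volterra variable is `|r| max(1, |a|)`: passing from `(r, a)` to `(r y x, |a| / x)`
multiplies it by at most `y`. -/
theorem norm_kernelOp_le {q : ℝ → ℂ} (hq : Continuous q) (k : C(ℝ × ℝ, ℂ)) {r a l Q C : ℝ}
    (hQ : ∀ x, |x| ≤ |r| * max 1 |a| → ‖q x‖ ≤ Q) (hC : 0 ≤ C) (hl : 0 ≤ l)
    (hk : ∀ ρ b, |b| ≤ max 1 |a| → |ρ| * max 1 |b| ≤ |r| * max 1 |a| →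
      ‖k (ρ, b)‖ ≤ C * Real.exp (l * (|ρ| * max 1 |b|))) :
    ‖kernelOp hq k (r, a)‖ ≤ (|r| * max 1 |a|) ^ 2 * (Q * C) *
      ∫ y in (0 : ℝ)..1, Real.exp (l * (|r| * max 1 |a|) * y) := by
  set m := max 1 |a| with hm
  have hm1 : 1 ≤ m := le_max_left _ _
  have hQ0 : 0 ≤ Q := (norm_nonneg _).trans (hQ 0 (by simp; positivity))
  rw [kernelOp_apply, norm_mul, norm_pow, Complex.norm_real, Real.norm_eq_abs, mul_pow, mul_assoc,
    mul_assoc]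
  refine mul_le_mul_of_nonneg_left ?_ (by positivity)
  rw [← intervalIntegral.integral_const_mul, ← intervalIntegral.integral_const_mul]
  refine intervalIntegral.norm_integral_le_of_norm_le zero_le_one ?_
    (Continuous.intervalIntegrable (by fun_prop) _ _)
  refine Filter.Eventually.of_forall fun y hy => ?_
  have hinner : ∀ x ∈ uIoc |a| 1, ‖kernelIntegrand q k (r * y) a x‖ ≤
      Q * (m * (C * Real.exp (l * (|r| * m) * y))) := by
    intro x hx
    obtain ⟨hx0, hxm, hdiv, hmin⟩ := pos_and_div_le_of_mem_uIoc hx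
    have hb : 0 ≤ |a| / x := by positivity
    rw [abs_of_pos hx0] at hdiv
    have hprod : |r * y * x| * max 1 (|(|a| / x)|) ≤ |r| * m * y := by
      rw [abs_mul, abs_mul, abs_of_pos hy.1, abs_of_pos hx0, abs_of_nonneg hb,
        mul_assoc (|r| * y), mul_max_of_nonneg _ _ hx0.le, mul_one, mul_div_cancel₀ _ hx0.ne',
        mul_right_comm]
      have : max x |a| ≤ m := max_le hxm (le_max_right _ _)
      have := hy.1.le
      gcongr
    have hy1 : |r| * m * y ≤ |r| * m := mul_le_of_le_one_right (by positivity) hy.2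
    have hsx : |r * y * x| ≤ |r| * m :=
      ((le_mul_of_one_le_right (abs_nonneg _) (le_max_left _ _)).trans hprod).trans hy1
    unfold kernelIntegrand
    rw [hmin, norm_mul, norm_mul, Complex.norm_real, Real.norm_of_nonneg hx0.le]
    have h1 := hQ _ hsx
    have h2 := hk (r * y * x) (|a| / x) (by rwa [abs_of_nonneg hb]) (hprod.trans hy1)
    have h3 : Real.exp (l * (|r * y * x| * max 1 (|(|a| / x)|))) ≤
        Real.exp (l * (|r| * m) * y) := by
      rw [Real.exp_le_exp, mul_assoc l]
      exact mul_le_mul_of_nonneg_left hprod hl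
    have h4 := h2.trans (mul_le_mul_of_nonneg_left h3 hC)
    gcongr
  have h1 := intervalIntegral.norm_integral_le_of_norm_le_const hinner
  have h2 : abs (1 - |a|) ≤ m := by
    rw [abs_le]
    constructor
    · linarith [le_max_right 1 |a|]
    · linarith [abs_nonneg a]
  rw [norm_mul, norm_pow, Complex.norm_real, Real.norm_of_nonneg hy.1.le]
  have h3 : y ^ 3 ≤ 1 := pow_le_one₀ hy.1.le hy.2
  calc y ^ 3 * ‖∫ x in |a|..1, kernelIntegrand q k (r * y) a x‖
      ≤ 1 * (Q * (m * (C * Real.exp (l * (|r| * m) * y))) * abs (1 - |a|)) := by gcongr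
    _ ≤ 1 * (Q * (m * (C * Real.exp (l * (|r| * m) * y))) * m) := by gcongr
    _ = _ := by ring

theorem isWeightedContraction_kernelOp {q : ℝ → ℂ} (hq : Continuous q) :
    ContinuousMap.IsWeightedContraction (kernelOp hq) := by
  intro K hK
  obtain ⟨N₀, hN₀⟩ := hK.isBounded.exists_norm_le
  set N := max 1 N₀ with hN
  have hN1 : 1 ≤ N := le_max_left _ _
  obtain ⟨Q₀, hQ₀⟩ := (isCompact_Icc (a := -(N * N)) (b := N * N)).exists_bound_of_continuousOn
    hq.continuousOn
  set Q := |Q₀| with hQ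
  have hqQ : ∀ x, |x| ≤ N * N → ‖q x‖ ≤ Q := fun x hx =>
    (hQ₀ x (abs_le.1 hx)).trans (le_abs_self _)
  -- The first term beats `2 Q w` for every `w ≤ N²`; the `1` keeps `l` positive when `Q = 0`.
  set l := 2 * (Q * (N * N)) + 1 with hl
  have hl0 : 0 < l := by positivity
  -- Both conditions are inherited by the points at which the operator evaluates `k`, since `|a| / x
  -- ≤ max(1, |a|) ≤ N`.
  let K' : Set (ℝ × ℝ) := {p | |p.2| ≤ N ∧ |p.1| * max 1 |p.2| ≤ N * N}
  have hK'c : IsCompact K' := by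
    refine Metric.isCompact_of_isClosed_isBounded ?_ ?_
    · have h1 : IsClosed {p : ℝ × ℝ | |p.2| ≤ N} := isClosed_le (by fun_prop) (by fun_prop)
      have h2 : IsClosed {p : ℝ × ℝ | |p.1| * max 1 |p.2| ≤ N * N} :=
        isClosed_le (by fun_prop) (by fun_prop)
      exact h1.inter h2
    · refine isBounded_iff_forall_norm_le.2 ⟨N * N, fun p hp => ?_⟩
      rw [Prod.norm_def]
      refine max_le ?_ ?_
      · exact (le_mul_of_one_le_right (abs_nonneg _) (le_max_left _ _)).trans hp.2
      · exact hp.1.trans (le_mul_of_one_le_right (by positivity) hN1)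
  refine ⟨K', hK'c, fun p hp => ?_, fun p => Real.exp (l * (|p.1| * max 1 |p.2|)),
    Real.exp (l * (N * N)), fun p hp => ⟨Real.one_le_exp (by positivity), ?_⟩, ?_⟩
  · have h := (hN₀ p hp).trans (le_max_right 1 N₀)
    rw [Prod.norm_def, max_le_iff] at h
    exact ⟨h.2, mul_le_mul h.1 (max_le hN1 h.2) (by positivity) (by positivity)⟩
  · exact Real.exp_le_exp.2 (mul_le_mul_of_nonneg_left hp.2 hl0.le)
  · rintro k C hC hk ⟨r, a⟩ ⟨ha, hra⟩
    simp only at ha hra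
    set w := |r| * max 1 |a| with hw
    have hw0 : 0 ≤ w := by positivity
    refine (norm_kernelOp_le hq k (Q := Q) (C := C) (l := l) (fun x hx => hqQ x (hx.trans hra)) hC
      hl0.le fun ρ b hb hρ => hk (ρ, b) ⟨?_, hρ.trans hra⟩).trans ?_
    · exact hb.trans (max_le hN1 ha)
    · have h1 := mul_integral_exp_le (x := w) hl0
      rw [le_div_iff₀ hl0] at h1
      rw [← hw]
      set I := ∫ y in (0 : ℝ)..1, Real.exp (l * w * y) with hI
      have hI0 : 0 ≤ I := intervalIntegral.integral_nonneg zero_le_one fun s _ => (Real.exp_pos _).le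
      have h2 : 2 * (Q * w) * (w * I) ≤ w * I * l := by
        have : 2 * (Q * w) ≤ l := by
          have : Q * w ≤ Q * (N * N) := mul_le_mul_of_nonneg_left hra (abs_nonneg _)
          linarith
        nlinarith [mul_nonneg hw0 hI0]
      calc w ^ 2 * (Q * C) * I = C / 2 * (2 * (Q * w) * (w * I)) := by ring
        _ ≤ C / 2 * Real.exp (l * w) :=
          mul_le_mul_of_nonneg_left (h2.trans h1) (by positivity)

theorem exists_kernelOp_solution {q : ℝ → ℂ} (hq : Continuous q) :
    ∃ k : C(ℝ × ℝ, ℂ), ∀ r a : ℝ, k (r, a) =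
      (∫ y in (0 : ℝ)..1, (y : ℂ) * q (r * y * |a|)) + (r : ℂ) ^ 2 * ∫ y in (0 : ℝ)..1, (y : ℂ) ^ 3 *
        ∫ x in |a|..1, kernelIntegrand q k (r * y) a x := by
  have hc : Continuous fun p : ℝ × ℝ => ∫ y in (0 : ℝ)..1, (y : ℂ) * q (p.1 * y * |p.2|) := by
    fun_prop
  obtain ⟨k, hk⟩ := (isWeightedContraction_kernelOp hq).oneSubEquiv.surjective ⟨_, hc⟩
  refine ⟨k, fun r a => ?_⟩
  rw [ContinuousMap.IsWeightedContraction.oneSubEquiv_apply, sub_eq_iff_eq_add] at hk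
  conv_lhs => rw [hk]
  rfl

end Transmutation

/-! ### Characteristic coordinates and the differential equation. -/

namespace Transmutation

/-- The kernel `r² k(r, √(1 - t))` in characteristic coordinates. -/
noncomputable def goursatFun (k : ℝ × ℝ → ℂ) (x : ℝ × ℝ) : ℂ :=
  (x.1 : ℂ) ^ 2 * k (x.1 * Real.exp x.2, Real.exp (-x.2))

/-- The coefficient of the Goursat problem. -/
noncomputable def goursatCoeff (q : ℝ → ℂ) (x : ℝ × ℝ) : ℂ :=
  (x.1 : ℂ) * (Real.exp x.2 : ℂ) ^ 2 * q (x.1 * Real.exp x.2)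

/-- The substitution `x = e^{η - t}` turns the inner Volterra integral into the integral along a
characteristic. -/
theorem kernelIntegral_exp_eq {q : ℝ → ℂ} (hq : Continuous q) {k : ℝ × ℝ → ℂ} (hk : Continuous k)
    (s t : ℝ) :
    (s : ℂ) ^ 3 * (Real.exp t : ℂ) ^ 2 *
      ∫ x in |Real.exp (-t)|..1, kernelIntegrand q k (s * Real.exp t) (Real.exp (-t)) x =
    ∫ η in (0 : ℝ)..t, goursatCoeff q (s, η) * goursatFun k (s, η) := by
  have hg : Continuous (kernelIntegrand q k (s * Real.exp t) (Real.exp (-t))) :=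
    (continuous_kernelIntegrand hq hk).comp (Continuous.prodMk_right (_, _))
  have h := intervalIntegral.integral_deriv_smul_comp (a := 0) (b := t)
    (f := fun η : ℝ => Real.exp (η - t)) (f' := fun η => Real.exp (η - t))
    (g := kernelIntegrand q k (s * Real.exp t) (Real.exp (-t)))
    (fun x _ => by simpa using ((hasDerivAt_id x).sub_const t).exp) (by fun_prop) hg
  simp only [zero_sub, sub_self, Real.exp_zero] at h
  rw [abs_of_pos (Real.exp_pos _), ← h, ← intervalIntegral.integral_const_mul]
  refine intervalIntegral.integral_congr fun η hη => ?_
  have he : Real.exp t * Real.exp (η - t) = Real.exp η := by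
    rw [← Real.exp_add]
    congr 1
    ring
  have hd : Real.exp (-t) / Real.exp (η - t) = Real.exp (-η) := by
    rw [← Real.exp_sub]
    congr 1
    ring
  have hmin : min (Real.exp (-η)) (1 + Real.exp (-t)) = Real.exp (-η) := by
    refine min_eq_left ?_
    rw [mem_uIcc] at hη
    rcases hη with hη | hη
    · have := Real.exp_le_one_iff.2 (neg_nonpos.2 hη.1)
      have := Real.exp_pos (-t)
      linarith
    · have := Real.exp_le_exp.2 (neg_le_neg hη.1)
      linarith
  have hec : (Real.exp η : ℂ) = Real.exp t * Real.exp (η - t) := by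
    rw [← he]
    push_cast
    rfl
  simp only [Function.comp_apply, kernelIntegrand, abs_of_pos (Real.exp_pos _), hd, hmin,
    mul_assoc s, he, goursatCoeff, goursatFun, Complex.real_smul, hec]
  ring

theorem goursatFun_eq_integral {q : ℝ → ℂ} (hq : Continuous q) {k : ℝ × ℝ → ℂ} (hk : Continuous k)
    (h : ∀ r a : ℝ, k (r, a) =
      (∫ y in (0 : ℝ)..1, (y : ℂ) * q (r * y * |a|)) + (r : ℂ) ^ 2 * ∫ y in (0 : ℝ)..1, (y : ℂ) ^ 3 *
        ∫ x in |a|..1, kernelIntegrand q k (r * y) a x) (p t : ℝ) :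
    goursatFun k (p, t) = ∫ s in (0 : ℝ)..p,
      goursatDeriv (fun s => s * q s) (goursatCoeff q) (goursatFun k) (s, t) := by
  -- The outer variable is rescaled by `s = p y`.
  have h1 := intervalIntegral.smul_integral_comp_mul_left (a := 0) (b := 1)
    (fun s => goursatDeriv (fun s => s * q s) (goursatCoeff q) (goursatFun k) (s, t)) p
  rw [mul_zero, mul_one] at h1
  rw [← h1]
  rw [show goursatFun k (p, t) = (p : ℂ) ^ 2 * k (p * Real.exp t, Real.exp (-t)) from rfl,
    h, mul_add, ← intervalIntegral.integral_const_mul, ← intervalIntegral.integral_const_mul,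
    ← intervalIntegral.integral_const_mul, ← intervalIntegral.integral_add,
    ← intervalIntegral.integral_smul]
  · refine intervalIntegral.integral_congr fun y _ => ?_
    have h2 := kernelIntegral_exp_eq hq hk (p * y) t
    have he : p * Real.exp t * y * |Real.exp (-t)| = p * y := by
      rw [abs_of_pos (Real.exp_pos _), mul_right_comm p, mul_assoc, ← Real.exp_add]
      simp
    have hc : p * Real.exp t * y = p * y * Real.exp t := by ring
    simp only [goursatDeriv]
    rw [← h2, he, hc, Complex.real_smul]
    push_cast
    ring
  · exact Continuous.intervalIntegrable (by fun_prop) _ _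
  · refine Continuous.intervalIntegrable ?_ _ _
    exact continuous_const.mul (continuous_const.mul (Continuous.mul (by fun_prop)
      (continuous_kernelOp_inner hq hk _ _)))

/-- `τ(t) = -½ log (1 - t)`. -/
noncomputable def charTime (t : ℝ) : ℝ := -(Real.log (1 - t) / 2)

theorem exp_neg_charTime {t : ℝ} (ht : t < 1) : Real.exp (-charTime t) = √(1 - t) := by
  rw [charTime, neg_neg, Real.sqrt_eq_rpow, Real.rpow_def_of_pos (by linarith)]
  ring_nf

theorem hasDerivAt_charTime {t : ℝ} (ht : t < 1) :
    HasDerivAt charTime (1 / (2 * (1 - t))) t := by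
  have h := ((((hasDerivAt_id t).const_sub 1).log (by simpa using (sub_pos.2 ht).ne')).div_const
    2).neg
  have ht' : 1 - t ≠ 0 := (sub_pos.2 ht).ne'
  have hv : -(-1 / (1 - t) / 2) = 1 / (2 * (1 - t)) := by
    field_simp
  rw [← hv]
  exact h

theorem contDiffOn_charTime : ContDiffOn ℝ 2 charTime (Iio 1) := by
  refine ((ContDiffOn.log (by fun_prop) fun t ht => ?_).div_const 2).neg
  exact (sub_pos.2 ht).ne'

theorem kernel_eq_goursatFun (k : ℝ × ℝ → ℂ) (r : ℝ) {t : ℝ} (ht : t < 1) :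
    (r : ℂ) ^ 2 * k (r, √(1 - t)) = (Real.exp (charTime t) : ℂ) ^ 2 *
      goursatFun k (r * Real.exp (-charTime t), charTime t) := by
  have h : Real.exp (-charTime t) * Real.exp (charTime t) = 1 := by
    rw [← Real.exp_add]
    simp
  have hc : (Real.exp (-charTime t) : ℂ) * Real.exp (charTime t) = 1 := by
    exact_mod_cast h
  rw [goursatFun]
  simp only
  rw [mul_assoc r, h, mul_one, exp_neg_charTime ht, ← exp_neg_charTime ht, Complex.ofReal_mul]
  linear_combination (-(r : ℂ) ^ 2 * k (r, Real.exp (-charTime t)) *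
    ((Real.exp (-charTime t) : ℂ) * Real.exp (charTime t) + 1)) * hc

/-- With `A = M_p` one has `G_r = e^τ A` and `G_rr = A_p`. As `2 (1 - t) ∂_t` is `∂_τ` at fixed `r`,
it sends `G_r` to `e^τ A - r A_p + e^τ V M`. The terms in `A` and `A_p` cancel against `-G_r` and `r
G_rr`. -/
theorem kernel_pde {φ : ℝ → ℂ} {V M : ℝ × ℝ → ℂ} (hφ : ContDiff ℝ 1 φ) (hV : ContDiff ℝ 1 V)
    (hM : ContDiff ℝ 2 M)
    (hE : ∀ p t, M (p, t) = ∫ s in (0 : ℝ)..p, goursatDeriv φ V M (s, t)) {G : ℝ → ℝ → ℂ}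
    (hG : ∀ r, ∀ t < 1, G r t = (Real.exp (charTime t) : ℂ) ^ 2 *
      M (r * Real.exp (-charTime t), charTime t)) (r : ℝ) {t : ℝ} (ht : t < 1) :
    (r : ℂ) * deriv (fun s => deriv (fun s' => G s' t) s) r - deriv (fun s => G s t) r
      + 2 * (1 - (t : ℂ)) * deriv (fun τ => deriv (fun s => G s τ) r) t =
    (Real.exp (charTime t) : ℂ) * (V (r * Real.exp (-charTime t), charTime t) *
      M (r * Real.exp (-charTime t), charTime t)) := by
  set A := goursatDeriv φ V M with hA
  have hexp : ∀ τ, (Real.exp τ : ℂ) * Real.exp (-τ) = 1 := fun τ => by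
    rw [← Complex.ofReal_mul, ← Real.exp_add]
    simp
  have hM1 : ContDiff ℝ 1 M := hM.of_le (by norm_num)
  have hA1 : ContDiff ℝ 1 A := contDiff_goursatDeriv hφ hV hM1
  have hMA := hasDerivAt_goursat_fst hφ.continuous hV.continuous hM.continuous hE
  have hGr : ∀ s, ∀ τ < 1, deriv (fun s' => G s' τ) s =
      (Real.exp (charTime τ) : ℂ) * A (s * Real.exp (-charTime τ), charTime τ) := by
    intro s τ hτ
    simp only [hG _ τ hτ]
    have h1 : HasDerivAt (fun s' : ℝ => s' * Real.exp (-charTime τ)) (Real.exp (-charTime τ)) s := by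
      simpa using (hasDerivAt_id s).mul_const (Real.exp (-charTime τ))
    have h2 := ((hMA _ (charTime τ)).scomp s h1).const_mul ((Real.exp (charTime τ) : ℂ) ^ 2)
    refine h2.deriv.trans ?_
    rw [Complex.real_smul]
    linear_combination (Real.exp (charTime τ) : ℂ) *
      A (s * Real.exp (-charTime τ), charTime τ) * hexp (charTime τ)
  set τ := charTime t with hτ
  set x : ℝ × ℝ := (r * Real.exp (-τ), τ) with hx
  have hAd : HasFDerivAt A (fderiv ℝ A x) x := (hA1.differentiable one_ne_zero x).hasFDerivAt
  have hAτ : fderiv ℝ A x (0, 1) = V x * M x := by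
    have h1 : HasDerivAt (fun u => A (r * Real.exp (-τ), u)) (fderiv ℝ A x (0, 1)) τ :=
      hAd.comp_hasDerivAt τ ((hasDerivAt_const τ (r * Real.exp (-τ))).prodMk (hasDerivAt_id τ))
    exact h1.unique (hasDerivAt_goursatDeriv_snd hV.continuous hM.continuous _ _)
  have hGrr : deriv (fun s => deriv (fun s' => G s' t) s) r = fderiv ℝ A x (1, 0) := by
    simp only [hGr _ t ht]
    have h1 : HasDerivAt (fun s : ℝ => (s * Real.exp (-τ), τ)) (Real.exp (-τ), 0) r :=
      (by simpa using (hasDerivAt_id r).mul_const (Real.exp (-τ)) :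
        HasDerivAt (fun s : ℝ => s * Real.exp (-τ)) (Real.exp (-τ)) r).prodMk
        (hasDerivAt_const r τ)
    have h2 := (hAd.comp_hasDerivAt r h1).const_mul (Real.exp τ : ℂ)
    refine h2.deriv.trans ?_
    rw [show ((Real.exp (-τ), 0) : ℝ × ℝ) = Real.exp (-τ) • (1, 0) by simp, map_smul,
      Complex.real_smul, ← mul_assoc, hexp, one_mul]
  have hGrt : deriv (fun u => deriv (fun s => G s u) r) t =
      ((1 / (2 * (1 - t)) : ℝ) : ℂ) * ((Real.exp τ : ℂ) * A x - r * fderiv ℝ A x (1, 0) +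
        Real.exp τ * (V x * M x)) := by
    have hev : (fun u => deriv (fun s => G s u) r) =ᶠ[𝓝 t] fun u =>
        (Real.exp (charTime u) : ℂ) * A (r * Real.exp (-charTime u), charTime u) := by
      filter_upwards [Iio_mem_nhds ht] with u hu
      exact hGr r u hu
    rw [hev.deriv_eq]
    have hpath : HasDerivAt (fun u : ℝ => (r * Real.exp (-u), u)) (-(r * Real.exp (-τ)), 1) τ := by
      refine HasDerivAt.prodMk ?_ (hasDerivAt_id τ)
      simpa using ((hasDerivAt_neg τ).exp).const_mul r
    have h1 : HasDerivAt (fun u : ℝ => (Real.exp u : ℂ) * A (r * Real.exp (-u), u))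
        ((Real.exp τ : ℂ) * A x + Real.exp τ * fderiv ℝ A x (-(r * Real.exp (-τ)), 1)) τ :=
      (Real.hasDerivAt_exp τ).ofReal_comp.mul
        (HasFDerivAt.comp_hasDerivAt (f := fun u : ℝ => (r * Real.exp (-u), u)) τ hAd hpath)
    have h2 := h1.scomp t (hasDerivAt_charTime ht)
    refine h2.deriv.trans ?_
    rw [Complex.real_smul]
    congr 1
    rw [show ((-(r * Real.exp (-τ)), 1) : ℝ × ℝ) =
      (-(r * Real.exp (-τ))) • (1, 0) + (0, 1) by simp, map_add, map_smul, hAτ, Complex.real_smul]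
    push_cast
    have := hexp τ
    push_cast at this
    linear_combination (-(r : ℂ) * fderiv ℝ A x (1, 0)) * this
  rw [hGrr, hGrt, hGr r t ht]
  have h1t : (1 - (t : ℂ)) ≠ 0 := by
    have : ((1 - t : ℝ) : ℂ) ≠ 0 := by exact_mod_cast (sub_pos.2 ht).ne'
    simpa using this
  push_cast
  field_simp
  ring

/-! ### Existence of kernels and the main theorem. -/

/-- Extend the derivative by its endpoint values and integrate. -/
theorem exists_contDiff_extension {ϱ : ℝ} (hϱ : 0 < ϱ) {q : ℝ → ℂ}
    (hq : ContDiffOn ℝ 1 q (Icc 0 ϱ)) :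
    ∃ p : ℝ → ℂ, ContDiff ℝ 1 p ∧ EqOn p q (Icc 0 ϱ) := by
  have hd : ContinuousOn (derivWithin q (Icc 0 ϱ)) (Icc 0 ϱ) :=
    hq.continuousOn_derivWithin (uniqueDiffOn_Icc hϱ) le_rfl
  have hc : Continuous (IccExtend hϱ.le ((Icc 0 ϱ).domRestrict (derivWithin q (Icc 0 ϱ)))) :=
    (continuousOn_iff_continuous_domRestrict.1 hd).Icc_extend'
  have hder : ∀ x, HasDerivAt (fun x => q 0 + ∫ s in (0 : ℝ)..x,
      IccExtend hϱ.le ((Icc 0 ϱ).domRestrict (derivWithin q (Icc 0 ϱ))) s)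
      (IccExtend hϱ.le ((Icc 0 ϱ).domRestrict (derivWithin q (Icc 0 ϱ))) x) x := fun x =>
    ((hc.integral_hasStrictDerivAt 0 x).hasDerivAt).const_add (q 0)
  refine ⟨_, contDiff_one_iff_deriv.2 ⟨fun x => (hder x).differentiableAt, ?_⟩, ?_⟩
  · exact hc.congr fun x => (hder x).deriv.symm
  · intro x hx
    have h0x : uIcc 0 x ⊆ Icc 0 ϱ := by
      rw [uIcc_of_le hx.1]
      exact Icc_subset_Icc_right hx.2
    have h1 : ∫ s in (0 : ℝ)..x,
        IccExtend hϱ.le ((Icc 0 ϱ).domRestrict (derivWithin q (Icc 0 ϱ))) s = q x - q 0 := by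
      refine intervalIntegral.integral_eq_sub_of_hasDerivAt_of_le hx.1
        (hq.continuousOn.mono (Icc_subset_Icc_right hx.2)) (fun s hs => ?_)
        (hc.intervalIntegrable _ _)
      have hs' : s ∈ Icc 0 ϱ := ⟨hs.1.le, hs.2.le.trans hx.2⟩
      rw [IccExtend_of_mem _ _ hs']
      exact ((hq.differentiableOn one_ne_zero s hs').hasDerivWithinAt).hasDerivAt
        (Icc_mem_nhds hs.1 (hs.2.trans_le hx.2))
    simp only [h1, add_sub_cancel]

theorem exists_isKernel {ϱ : ℝ} (hϱ : 0 < ϱ) {q : ℝ → ℂ} (hq : ContDiffOn ℝ 1 q (Icc 0 ϱ)) :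
    ∃ G, IsKernel ϱ q G := by
  obtain ⟨p, hp, hpq⟩ := exists_contDiff_extension hϱ hq
  obtain ⟨k, hk⟩ := exists_kernelOp_solution hp.continuous
  have hφ : ContDiff ℝ 1 fun s : ℝ => (s : ℂ) * p s :=
    (Complex.ofRealCLM.contDiff).mul hp
  have hV : ContDiff ℝ 1 (goursatCoeff p) := by
    have h1 : ContDiff ℝ 1 fun x : ℝ × ℝ => (x.1 : ℂ) := Complex.ofRealCLM.contDiff.comp contDiff_fst
    have h2 : ContDiff ℝ 1 fun x : ℝ × ℝ => (Real.exp x.2 : ℂ) :=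
      Complex.ofRealCLM.contDiff.comp (Real.contDiff_exp.comp contDiff_snd)
    exact (h1.mul (h2.pow 2)).mul (hp.comp (by fun_prop))
  have hE := goursatFun_eq_integral hp.continuous k.continuous hk
  have hMc : Continuous (goursatFun k) := by
    unfold goursatFun
    fun_prop
  have hM := contDiff_two_goursat hφ hV hMc hE
  have hG : ∀ r t : ℝ, t < 1 → (r : ℂ) ^ 2 * k (r, √(1 - t)) = (Real.exp (charTime t) : ℂ) ^ 2 *
      goursatFun k (r * Real.exp (-charTime t), charTime t) := fun r t ht =>
    kernel_eq_goursatFun k r ht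
  refine ⟨fun r t => (r : ℂ) ^ 2 * k (r, √(1 - t)), Continuous.continuousOn (by fun_prop), ?_, ?_,
    ?_, fun t _ => by simp⟩
  · have hτ : ContDiffOn ℝ 2 (fun x : ℝ × ℝ => charTime x.2) (Icc 0 ϱ ×ˢ Ico 0 1) :=
      contDiffOn_charTime.comp contDiffOn_snd fun x hx => hx.2.2
    have h1 : ContDiffOn ℝ 2 (fun x : ℝ × ℝ => (Real.exp (charTime x.2) : ℂ))
        (Icc 0 ϱ ×ˢ Ico 0 1) :=
      Complex.ofRealCLM.contDiff.comp_contDiffOn hτ.exp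
    have h2 : ContDiffOn ℝ 2 (fun x : ℝ × ℝ => (x.1 * Real.exp (-charTime x.2), charTime x.2))
        (Icc 0 ϱ ×ˢ Ico 0 1) := (contDiffOn_fst.mul hτ.neg.exp).prodMk hτ
    exact ((h1.pow 2).mul (hM.comp_contDiffOn h2)).congr fun x hx => hG x.1 x.2 hx.2.2
  · intro r hr t ht
    have h1 := kernel_pde hφ hV hM hE hG r ht.2
    have h2 := hG r t ht.2
    have h3 : (Real.exp (charTime t) : ℂ) * Real.exp (-charTime t) = 1 := by
      rw [← Complex.ofReal_mul, ← Real.exp_add]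
      simp
    have h4 : r * Real.exp (-charTime t) * Real.exp (charTime t) = r := by
      rw [mul_assoc, ← Real.exp_add]
      simp
    have h5 : (Real.exp (charTime t) : ℂ) *
        (goursatCoeff p (r * Real.exp (-charTime t), charTime t) *
          goursatFun k (r * Real.exp (-charTime t), charTime t)) =
        r * (q r * ((r : ℂ) ^ 2 * k (r, √(1 - t)))) := by
      rw [h2, ← hpq (Ioo_subset_Icc_self hr)]
      generalize hm : goursatFun k (r * Real.exp (-charTime t), charTime t) = m
      simp only [goursatCoeff, h4, Complex.ofReal_mul]
      linear_combination (r * (Real.exp (charTime t) : ℂ) ^ 2 * p r * m) * h3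
    rw [h5] at h1
    linear_combination h1
  · intro r hr
    have h1 := hG r 0 one_pos
    have h0 : charTime 0 = 0 := by simp [charTime]
    -- At `τ = 0` the integral along the characteristic is empty, leaving only the prescribed data.
    rw [h0, neg_zero, Real.exp_zero, mul_one, hE] at h1
    simp only [Complex.ofReal_one, one_pow, one_mul] at h1
    rw [h1]
    refine intervalIntegral.integral_congr fun s hs => ?_
    rw [uIcc_of_le hr.1] at hs
    simp [goursatDeriv, hpq (Icc_subset_Icc_right hr.2 hs)]

theorem outerRadius_pos {Ω : Set ℂ} (ho : IsOpen Ω) (h0 : (0 : ℂ) ∈ Ω)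
    (hb : Bornology.IsBounded Ω) : 0 < outerRadius Ω := by
  obtain ⟨ε, hε, hball⟩ := Metric.isOpen_iff.1 ho 0 h0
  have hmem : ((ε / 2 : ℝ) : ℂ) ∈ Ω := by
    apply hball
    rw [mem_ball_zero_iff, Complex.norm_real, Real.norm_of_nonneg (by positivity)]
    linarith
  have h := (norm_mem_Icc hb hmem).2
  rw [Complex.norm_real, Real.norm_of_nonneg (by positivity)] at h
  linarith

theorem contDiffOn_darbouxPotential {ϱ : ℝ} (hϱ : 0 < ϱ) {f q : ℝ → ℂ}
    (hq : ContDiffOn ℝ 1 q (Icc 0 ϱ)) (hf : ContDiffOn ℝ 2 f (Icc 0 ϱ))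
    (hf0 : ∀ r ∈ Icc 0 ϱ, f r ≠ 0) : ContDiffOn ℝ 1 (darbouxPotential ϱ f q) (Icc 0 ϱ) := by
  have h1 : ContDiffOn ℝ 1 (derivWithin f (Icc 0 ϱ)) (Icc 0 ϱ) :=
    hf.derivWithin (uniqueDiffOn_Icc hϱ) (by norm_num)
  have h2 : ContDiffOn ℝ 1 f (Icc 0 ϱ) := hf.of_le (by norm_num)
  have h3 : ContDiffOn ℝ 1 (fun r => derivWithin f (Icc 0 ϱ) r / f r) (Icc 0 ϱ) := by
    simp only [div_eq_mul_inv]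
    exact h1.mul (h2.inv hf0)
  exact (contDiffOn_const.mul (h3.pow 2)).sub hq

end Transmutation

theorem mainTheorem11 (Ω : Set ℂ) (hΩo : IsOpen Ω) (hΩ0 : (0 : ℂ) ∈ Ω)
    (hΩs : StarConvex ℝ 0 Ω) (hΩb : Bornology.IsBounded Ω) (q f : ℝ → ℂ)
    (hq : ContDiffOn ℝ 1 q (Icc 0 (Transmutation.outerRadius Ω)))
    (hf : ContDiffOn ℝ 2 f (Icc 0 (Transmutation.outerRadius Ω)))
    (hf0 : ∀ r ∈ Icc 0 (Transmutation.outerRadius Ω), f r ≠ 0)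
    (hfq : ∀ r ∈ Ioo 0 (Transmutation.outerRadius Ω),
      deriv (deriv f) r + 1 / (r : ℂ) * deriv f r - q r * f r = 0) :
    (∃ G, Transmutation.IsKernel (Transmutation.outerRadius Ω) q G) ∧
    (∃ G, Transmutation.IsKernel (Transmutation.outerRadius Ω)
      (Transmutation.darbouxPotential (Transmutation.outerRadius Ω) f q) G) ∧
    ∀ (G₁ G₂ : ℝ → ℝ → ℂ)
      (h₁ : Transmutation.IsKernel (Transmutation.outerRadius Ω) q G₁)
      (h₂ : Transmutation.IsKernel (Transmutation.outerRadius Ω)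
        (Transmutation.darbouxPotential (Transmutation.outerRadius Ω) f q) G₂),
      ∃ (T₁ T₂ : C(Ω, ℂ) ≃L[ℂ] C(Ω, ℂ)) (E₁ E₂ : C(Ω, Bicomplex) ≃L[ℂ] C(Ω, Bicomplex)),
        ⇑T₁ = Transmutation.radialOp hΩs hΩb h₁ ∧
        ⇑T₂ = Transmutation.radialOp hΩs hΩb h₂ ∧
        ⇑E₁ = Transmutation.bicomplexOp
          (Transmutation.radialOp hΩs hΩb h₁) (Transmutation.radialOp hΩs hΩb h₂) ∧
        ⇑E₁.symm = Transmutation.bicomplexOp T₁.symm T₂.symm ∧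
        ⇑E₂ = Transmutation.bicomplexOp
          (Transmutation.radialOp hΩs hΩb h₂) (Transmutation.radialOp hΩs hΩb h₁) ∧
        ⇑E₂.symm = Transmutation.bicomplexOp T₂.symm T₁.symm := by
  have hϱ := Transmutation.outerRadius_pos hΩo hΩ0 hΩb
  refine ⟨Transmutation.exists_isKernel hϱ hq, Transmutation.exists_isKernel hϱ
    (Transmutation.contDiffOn_darbouxPotential hϱ hq hf hf0), fun G₁ G₂ h₁ h₂ => ?_⟩
  have e₁ := Transmutation.coe_radialEquiv hΩo hΩs hΩb h₁
  have e₂ := Transmutation.coe_radialEquiv hΩo hΩs hΩb h₂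
  refine ⟨Transmutation.radialEquiv hΩo hΩs hΩb h₁, Transmutation.radialEquiv hΩo hΩs hΩb h₂,
    Transmutation.bicomplexEquiv (Transmutation.radialEquiv hΩo hΩs hΩb h₁)
      (Transmutation.radialEquiv hΩo hΩs hΩb h₂),
    Transmutation.bicomplexEquiv (Transmutation.radialEquiv hΩo hΩs hΩb h₂)
      (Transmutation.radialEquiv hΩo hΩs hΩb h₁), e₁, e₂, ?_, rfl, ?_, rfl⟩
  · rw [← e₁, ← e₂]
    rfl
  · rw [← e₁, ← e₂]
    rfl
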